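/- Let $n\ge 0$, $V=\mathbb{C}^n$ (column vectors), $V^*$ its dual (row vectors), $\mathfrak{g}=\mathfrak{gl}_n(\mathbb{C})$. Let $\mathbb{C}[X,Y,i,j]$ be the polynomial algebra of functions on $\mathfrak{g}\times\mathfrak{g}\times V\times V^*$, let $J$ be its ideal generated by the $n^2$ entries of the matrix $[X,Y]+ij$, and let $\mathcal{M}=\operatorname{Spec}\mathbb{C}[X,Y,i,j]/J$, an a priori non-reduced affine scheme. For $k\in\{0,1,\dots,n\}$ let $\mathcal{M}'_k$ be the set of (closed) points $(X,Y,i,j)\in\mathcal{M}$ such that $Y$ has pairwise distinct eigenvalues (counted with algebraic multiplicity, so $Y$ has $n$ different eigenvalues), $\dim(\mathbb{C}[X,Y]\,i)=n-k$ and $\dim(j\,\mathbb{C}[X,Y])=k$, where here $\mathbb{C}[X,Y]\subset\mathfrak{g}$ denotes the unital subalgebra generated by the matrices $X$ and $Y$. Let $\mathcal{M}_k$ be the closure of $\mathcal{M}'_k$ in $\mathcal{M}$. Then: (i) $\mathcal{M}$ is a complete intersection in $\mathfrak{g}\times\mathfrak{g}\times V\times V^*$, i.e. the ideal $J$ is generated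 by a regular sequence in $\mathbb{C}[X,Y,i,j]$. (ii) The irreducible components of $\mathcal{M}$ are exactly $\mathcal{M}_0,\dots,\mathcal{M}_n$, and these $n+1$ sets are pairwise distinct. (iii) $\mathcal{M}$ is reduced and equidimensional: $\dim\mathcal{M}=n^2+2n$, and every irreducible component of $\mathcal{M}$ has dimension $n^2+2n$. -/

import Mathlib

open AlgebraicGeometry MvPolynomial Matrix

noncomputable section

namespace AlmostCommuting

/-- Coordinates on `gl_n × gl_n × V × V^*`: the entries of `X`, of `Y`, of the column `i` and of
the row `j`, in this order. -/
abbrev Coord (n : ℕ) : Type := (Fin n × Fin n) ⊕ (Fin n × Fin n) ⊕ Fin n ⊕ Fin n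

/-- The polynomial algebra `ℂ[X, Y, i, j]`. -/
abbrev CoordRing (n : ℕ) : Type := MvPolynomial (Coord n) ℂ

/-- The matrix `[X, Y] + i j` over a commutative ring. -/
def moment {R : Type*} [CommRing R] {n : ℕ} (X Y : Matrix (Fin n) (Fin n) R) (i j : Fin n → R) :
    Matrix (Fin n) (Fin n) R :=
  X * Y - Y * X + vecMulVec i j

/-- The generic matrix `X`. -/
def genX (n : ℕ) : Matrix (Fin n) (Fin n) (CoordRing n) :=
  Matrix.of fun r s => MvPolynomial.X (Sum.inl (r, s))

/-- The generic matrix `Y`. -/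
def genY (n : ℕ) : Matrix (Fin n) (Fin n) (CoordRing n) :=
  Matrix.of fun r s => MvPolynomial.X (Sum.inr (Sum.inl (r, s)))

/-- The generic column vector `i`. -/
def genI (n : ℕ) : Fin n → CoordRing n :=
  fun r => MvPolynomial.X (Sum.inr (Sum.inr (Sum.inl r)))

/-- The generic row vector `j`. -/
def genJ (n : ℕ) : Fin n → CoordRing n :=
  fun r => MvPolynomial.X (Sum.inr (Sum.inr (Sum.inr r)))

/-- The ideal generated by the `n²` entries of the generic matrix `[X, Y] + i j`. -/
def J (n : ℕ) : Ideal (CoordRing n) :=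
  Ideal.span (Set.range fun p : Fin n × Fin n =>
    moment (genX n) (genY n) (genI n) (genJ n) p.1 p.2)

/-- The scheme `M = Spec ℂ[X, Y, i, j] / J`. -/
def M (n : ℕ) : Scheme := Spec (CommRingCat.of (CoordRing n ⧸ J n))

/-- Evaluation of polynomials at the point `(X, Y, i, j)`. -/
def evalAt {n : ℕ} (X Y : Matrix (Fin n) (Fin n) ℂ) (i j : Fin n → ℂ) : CoordRing n →+* ℂ :=
  MvPolynomial.eval (Sum.elim (fun p => X p.1 p.2)
    (Sum.elim (fun p => Y p.1 p.2) (Sum.elim i j)))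

theorem evalAt_moment {n : ℕ} (X Y : Matrix (Fin n) (Fin n) ℂ) (i j : Fin n → ℂ)
    (r s : Fin n) :
    evalAt X Y i j (moment (genX n) (genY n) (genI n) (genJ n) r s) = moment X Y i j r s := by
  simp [evalAt, moment, genX, genY, genI, genJ, Matrix.mul_apply, vecMulVec_apply]

theorem evalAt_eq_zero {n : ℕ} {X Y : Matrix (Fin n) (Fin n) ℂ} {i j : Fin n → ℂ}
    (h : moment X Y i j = 0) : ∀ f ∈ J n, evalAt X Y i j f = 0 := by
  have hle : J n ≤ RingHom.ker (evalAt X Y i j) := by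
    refine Ideal.span_le.2 ?_
    rintro _ ⟨p, rfl⟩
    have := evalAt_moment X Y i j p.1 p.2
    rw [h] at this
    exact this
  exact fun f hf => hle hf

/-- The closed point of the scheme `M` given by a quadruple `(X, Y, i, j)` of complex matrices
and vectors with `[X, Y] + i j = 0`: the kernel of evaluation at this quadruple. -/
def closedPoint {n : ℕ} {X Y : Matrix (Fin n) (Fin n) ℂ} {i j : Fin n → ℂ}
    (h : moment X Y i j = 0) : M n :=
  (⟨RingHom.ker (Ideal.Quotient.lift (J n) (evalAt X Y i j) (evalAt_eq_zero h)),
    RingHom.ker_isPrime _⟩ : PrimeSpectrum (CoordRing n ⧸ J n))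

/-- The subspace `ℂ[X, Y] i` of `V`, with `ℂ[X, Y]` the algebra of matrices generated by
`X` and `Y`. -/
def cyclicColumn {n : ℕ} (X Y : Matrix (Fin n) (Fin n) ℂ) (i : Fin n → ℂ) :
    Submodule ℂ (Fin n → ℂ) :=
  Submodule.span ℂ {v | ∃ A ∈ Algebra.adjoin ℂ {X, Y}, v = A *ᵥ i}

/-- The subspace `j ℂ[X, Y]` of `V^*`. -/
def cyclicRow {n : ℕ} (X Y : Matrix (Fin n) (Fin n) ℂ) (j : Fin n → ℂ) :
    Submodule ℂ (Fin n → ℂ) :=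
  Submodule.span ℂ {v | ∃ A ∈ Algebra.adjoin ℂ {X, Y}, v = j ᵥ* A}

/-- The locus `M'_k`, as a set of closed points of `M`: the eigenvalues of `Y` (the roots of its
characteristic polynomial, with multiplicity) are pairwise distinct, `dim ℂ[X, Y] i = n - k` and
`dim j ℂ[X, Y] = k`. -/
def stratum (n : ℕ) (k : Fin (n + 1)) : Set (M n) :=
  {x | ∃ (X Y : Matrix (Fin n) (Fin n) ℂ) (i j : Fin n → ℂ) (h : moment X Y i j = 0),
    Y.charpoly.roots.Nodup ∧
    Module.finrank ℂ (cyclicColumn X Y i) = n - (k : ℕ) ∧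
    Module.finrank ℂ (cyclicRow X Y j) = (k : ℕ) ∧
    x = closedPoint h}

/-- `M_k`, the closure of the locus `M'_k` in the scheme `M`. -/
def component (n : ℕ) (k : Fin (n + 1)) : Set (M n) := closure (stratum n k)

/-- The closed subscheme `Spec (R ⧸ I)` of `Spec R` is a complete intersection in `Spec R`:
its ideal is generated by a regular sequence. -/
def IsCompleteIntersection {R : Type*} [CommRing R] (I : Ideal R) : Prop :=
  ∃ fs : List R, RingTheory.Sequence.IsRegular R fs ∧ Ideal.ofList fs = I

end AlmostCommuting

end

/-!
A Lagrangian dimension count bounds the dimension of `M`, the bound makes `M` a complete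
intersection, and a complete intersection is understood once its generic points are.

*Dimension.* Let `P ⊇ J` be prime and `L` the algebraic closure of the fraction field of
`ℂ[X, Y, i, j] / P`. The dimension of the quotient is at most the dimension of `Der_ℂ(L, L)`
(`ringKrullDim_le_finrank_derivation`), and a derivation is determined by its values on the
coordinates, so `Der_ℂ(L, L)` embeds into the quadruples over `L`. This space carries the symplectic
form for which `[X, Y] + i j` is the moment map of `GL_n`. Over `L` the matrices `X` and `Y` can be
made triangular simultaneously, with `i r * j r = 0` for every `r` (`exists_matrix_triangular`).
The change of basis contributes a vector tangent to the group orbit, which the moment map equation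
makes orthogonal to all others; what remains of the form is `∑ dx_r ∧ dy_r` in the diagonal
entries. Hence derivations that kill the eigenvalues of `Y` form an isotropic subspace
(`symplecticForm_tangent_eq_zero`), and the dimension is at most `n² + n` plus the number of
distinct eigenvalues of `Y` over `L`. So `dim M ≤ n² + 2 n`, with strict inequality on
closed subsets where the discriminant of `Y` vanishes.

*Complete intersection.* Since `J` is generated by `n²` forms in `2 n² + 2 n` variables, the bound
makes the generators a regular sequence locally at the origin, hence globally by homogeneity
(`isRegular_of_isHomogeneous_of_ringKrullDim_le`). Moreover the quotient is Cohen-Macaulay: every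
associated prime of `J` has dimension `n² + 2 n`, so it is minimal and does not contain the
discriminant of `Y` (`ringKrullDim_quotient_of_mem_associatedPrimes`).

*Components.* Where `Y` has distinct eigenvalues a point of `M` has a normal form: `Y` is diagonal,
`i` and `j` have complementary supports, and the off-diagonal entries of `X` are determined
(`exists_normalForm`). Only the number `k` of coordinates that `j` may use is a discrete invariant,
so each locus `M'_k` is parametrized by an irreducible variety, and its vanishing ideal
`compIdeal n k` is prime. By the Nullstellensatz every minimal prime of `J` contains one of these
ideals, and the ranks of `ℂ[X, Y] i` and `j ℂ[X, Y]` show that they are pairwise incomparable.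

*Reducedness.* At a point of `M'_k` the differential of the moment map is onto, because its cokernel
is dual to the matrices `Z` with `[Z, X] = [Z, Y] = 0`, `Z i = 0`, `j Z = 0`, and the normal form
shows that `Z = 0` (`eq_zero_of_gauge_eq_zero`). By the Jacobian criterion `J` agrees with each of
its associated primes locally at that prime, so it is radical.
-/

noncomputable section

namespace AlmostCommuting

/-! ### Regular sequences over Noetherian local rings -/

section Depth

open IsLocalRing RingTheory.Sequence Pointwise

variable {A : Type*} [CommRing A]

theorem ringKrullDim_quotient_add_one_le_of_lt {p q : Ideal A} [p.IsPrime] (h : p < q) :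
    ringKrullDim (A ⧸ q) + 1 ≤ ringKrullDim (A ⧸ p) := by
  obtain ⟨x, hxq, hxp⟩ := Set.exists_of_ssubset h
  refine ringKrullDim_succ_le_of_surjective (Ideal.Quotient.factor h.le)
    (Ideal.Quotient.factor_surjective h.le) (r := Ideal.Quotient.mk p x) ?_ ?_
  · exact mem_nonZeroDivisors_of_ne_zero (by simpa [Ideal.Quotient.eq_zero_iff_mem] using hxp)
  · simpa [Ideal.Quotient.eq_zero_iff_mem] using hxq

theorem mem_maximalIdeal_of_isRegular_cons {M : Type*} [AddCommGroup M]
    [Module A M] [IsLocalRing A] {x : A} {rs : List A} (h : IsRegular M (x :: rs)) :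
    x ∈ maximalIdeal A := by
  by_contra hx
  have hu : IsUnit x := by simpa using hx
  refine h.2 ?_
  simp [Ideal.ofList_cons, Ideal.span_singleton_eq_top.mpr hu]

variable [IsNoetherianRing A] {M : Type*} [AddCommGroup M] [Module A M]

theorem isSMulRegular_iff_forall_notMem_associatedPrimes {x : A} :
    IsSMulRegular M x ↔ ∀ p ∈ associatedPrimes A M, x ∉ p := by
  have := biUnion_associatedPrimes_eq_zero_divisors A M
  rw [Set.ext_iff] at this
  have := this x
  simp only [Set.mem_iUnion, SetLike.mem_coe, exists_prop, Set.mem_ofPred_eq] at this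
  rw [isSMulRegular_iff_right_eq_zero_of_smul]
  constructor
  · intro h p hp hx
    obtain ⟨m, hm, hxm⟩ := this.1 ⟨p, hp, hx⟩
    exact hm (h m hxm)
  · intro h m hm
    by_contra hne
    obtain ⟨p, hp, hx⟩ := this.2 ⟨m, hne, hm⟩
    exact h p hp hx

variable [IsLocalRing A]

theorem exists_mem_maximalIdeal_isSMulRegular {M₁ M₂ : Type*} [AddCommGroup M₁] [Module A M₁]
    [AddCommGroup M₂] [Module A M₂] [Module.Finite A M₁] [Module.Finite A M₂]
    (h₁ : maximalIdeal A ∉ associatedPrimes A M₁) (h₂ : maximalIdeal A ∉ associatedPrimes A M₂) :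
    ∃ z ∈ maximalIdeal A, IsSMulRegular M₁ z ∧ IsSMulRegular M₂ z := by
  by_contra! hcon
  have hsub : (maximalIdeal A : Set A) ⊆
      ⋃ p ∈ associatedPrimes A M₁ ∪ associatedPrimes A M₂, (p : Set A) := by
    intro z hz
    simp only [Set.mem_iUnion, exists_prop]
    by_cases hz1 : IsSMulRegular M₁ z
    · have := hcon z hz hz1
      rw [isSMulRegular_iff_forall_notMem_associatedPrimes] at this
      push Not at this
      obtain ⟨p, hp, hzp⟩ := this
      exact ⟨p, Or.inr hp, hzp⟩
    · rw [isSMulRegular_iff_forall_notMem_associatedPrimes] at hz1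
      push Not at hz1
      obtain ⟨p, hp, hzp⟩ := hz1
      exact ⟨p, Or.inl hp, hzp⟩
  have hfin : (associatedPrimes A M₁ ∪ associatedPrimes A M₂).Finite :=
    (associatedPrimes.finite A M₁).union (associatedPrimes.finite A M₂)
  have hpr : ∀ p ∈ associatedPrimes A M₁ ∪ associatedPrimes A M₂, p.IsPrime := by
    rintro p (hp | hp)
    · exact hp.isPrime
    · exact hp.isPrime
  obtain ⟨p, hp, hle⟩ := (Ideal.subset_union_prime_finite hfin (f := id) ⊤ ⊤
    (fun p hp _ _ => hpr p hp)).1 hsub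
  have hpe : p = maximalIdeal A :=
    ((maximalIdeal.isMaximal A).eq_of_le (hpr p hp).ne_top hle).symm
  subst hpe
  exact hp.elim h₁ h₂

/-- Over a local ring, whether `M / x M` has depth zero does not depend on the choice of the regular
element `x` of the maximal ideal. -/
theorem maximalIdeal_mem_associatedPrimes_quotSMulTop {x y : A} (hx : IsSMulRegular M x)
    (hy : IsSMulRegular M y) (hxm : x ∈ maximalIdeal A)
    (h : maximalIdeal A ∈ associatedPrimes A (QuotSMulTop y M)) :
    maximalIdeal A ∈ associatedPrimes A (QuotSMulTop x M) := by
  have h' := (isAssociatedPrime_iff.1 h).2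
  obtain ⟨ub, hu⟩ := h'
  obtain ⟨u, rfl⟩ := Submodule.Quotient.mk_surjective _ ub
  have key : ∀ a ∈ maximalIdeal A, ∃ w, a • u = y • w := by
    intro a ha
    rw [hu, Submodule.mem_colon_singleton, Submodule.mem_bot, ← Submodule.Quotient.mk_smul,
      Submodule.Quotient.mk_eq_zero, Submodule.mem_smul_pointwise_iff_exists] at ha
    obtain ⟨w, -, hw⟩ := ha
    exact ⟨w, hw.symm⟩
  obtain ⟨v, hv⟩ := key x hxm
  have hv0 : (Submodule.Quotient.mk v : QuotSMulTop x M) ≠ 0 := by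
    intro h0
    rw [Submodule.Quotient.mk_eq_zero, Submodule.mem_smul_pointwise_iff_exists] at h0
    obtain ⟨w, -, rfl⟩ := h0
    rw [smul_comm] at hv
    have huw := hx hv
    have : (1 : A) ∈ maximalIdeal A := by
      rw [hu, Submodule.mem_colon_singleton, Submodule.mem_bot, one_smul,
        Submodule.Quotient.mk_eq_zero, huw]
      exact Submodule.smul_mem_pointwise_smul _ _ _ trivial
    exact (Ideal.ne_top_iff_one _).1 (maximalIdeal.isMaximal A).ne_top this
  have hle : maximalIdeal A ≤ (⊥ : Submodule A (QuotSMulTop x M)).colon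
      {(Submodule.Quotient.mk v : QuotSMulTop x M)} := by
    intro a ha
    obtain ⟨w, hw⟩ := key a ha
    rw [Submodule.mem_colon_singleton, Submodule.mem_bot, ← Submodule.Quotient.mk_smul,
      Submodule.Quotient.mk_eq_zero]
    have : y • (a • v) = y • (x • w) := by
      rw [smul_comm y a v, ← hv, smul_comm a x u, hw, smul_comm]
    rw [hy this]
    exact Submodule.smul_mem_pointwise_smul _ _ _ trivial
  obtain ⟨P, hP, hPle⟩ := exists_le_isAssociatedPrime_of_isNoetherianRing A _ hv0
  have hPe : maximalIdeal A = P :=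
    (maximalIdeal.isMaximal A).eq_of_le hP.isPrime.ne_top (hle.trans hPle)
  rw [hPe]
  exact hP

/-- The length of a regular sequence is at most the dimension of each associated prime: dividing by
the first element of the sequence leads to a strictly larger associated prime. -/
theorem length_le_ringKrullDim_of_mem_associatedPrimes {M : Type*} [AddCommGroup M] [Module A M]
    [Module.Finite A M] {rs : List A} (h : IsRegular M rs) {p : Ideal A}
    (hp : p ∈ associatedPrimes A M) : (rs.length : WithBot ℕ∞) ≤ ringKrullDim (A ⧸ p) := by
  induction rs generalizing M p with
  | nil =>
    have := hp.isPrime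
    simpa using ringKrullDim_nonneg_of_nontrivial (R := A ⧸ p)
  | cons x rs ih =>
    have hxm := mem_maximalIdeal_of_isRegular_cons h
    rw [isRegular_cons_iff] at h
    have hpp := hp.isPrime
    have hxp := isSMulRegular_iff_forall_notMem_associatedPrimes.1 h.1 p hp
    obtain ⟨z₀, hz₀⟩ := (isAssociatedPrime_iff.1 hp).2
    have hz₀0 : z₀ ≠ 0 := by
      rintro rfl
      apply hpp.ne_top
      rw [hz₀]; simp
    let T : Submodule A M :=
      { carrier := {z | ∀ a ∈ p, a • z = 0}
        add_mem' := fun {u v} hu hv a ha => by rw [smul_add, hu a ha, hv a ha, add_zero]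
        zero_mem' := fun a _ => smul_zero a
        smul_mem' := fun c u hu a ha => by rw [smul_comm, hu a ha, smul_zero] }
    have hz₀T : z₀ ∈ T := by
      intro a ha
      rw [hz₀, Submodule.mem_colon_singleton, Submodule.mem_bot] at ha
      exact ha
    obtain ⟨z, hzT, hzx⟩ : ∃ z ∈ T, z ∉ x • (⊤ : Submodule A M) := by
      by_contra! hcon
      have hle : T ≤ (Ideal.span {x}) • T := by
        intro z hz
        obtain ⟨w, -, rfl⟩ := (Submodule.mem_smul_pointwise_iff_exists _ _ _).1 (hcon z hz)
        refine Submodule.smul_mem_smul (Ideal.mem_span_singleton_self x) ?_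
        intro a ha
        have := hz a ha
        change a • x • w = 0 at this
        rw [smul_comm] at this
        exact isSMulRegular_iff_right_eq_zero_of_smul.1 h.1 _ this
      have hT : T = ⊥ := by
        refine Submodule.eq_bot_of_le_smul_of_le_jacobson_bot (Ideal.span {x}) T
          (IsNoetherian.noetherian T) hle ?_
        rw [Ideal.span_singleton_le_iff_mem]
        exact IsLocalRing.maximalIdeal_le_jacobson _ hxm
      rw [hT] at hz₀T
      exact hz₀0 hz₀T
    have hz0 : (Submodule.Quotient.mk z : QuotSMulTop x M) ≠ 0 := by
      rwa [ne_eq, Submodule.Quotient.mk_eq_zero]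
    obtain ⟨q, hq, hqle⟩ := exists_le_isAssociatedPrime_of_isNoetherianRing A _ hz0
    have hpq : p < q := by
      refine lt_of_le_of_ne (fun a ha => hqle ?_) ?_
      · rw [Submodule.mem_colon_singleton, Submodule.mem_bot, ← Submodule.Quotient.mk_smul,
          hzT a ha, Submodule.Quotient.mk_zero]
      · rintro rfl
        refine hxp (hqle ?_)
        rw [Submodule.mem_colon_singleton, Submodule.mem_bot, ← Submodule.Quotient.mk_smul,
          Submodule.Quotient.mk_eq_zero]
        exact Submodule.smul_mem_pointwise_smul _ _ _ trivial
    have := ih h.2 hq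
    calc ((x :: rs).length : WithBot ℕ∞) = (rs.length : WithBot ℕ∞) + 1 := by simp
      _ ≤ ringKrullDim (A ⧸ q) + 1 := by gcongr
      _ ≤ _ := ringKrullDim_quotient_add_one_le_of_lt hpq

/-- The exchange property behind the definition of depth: if `M` has a regular sequence of length
`r + 1` and `y` is regular on `M`, then `M / y M` has a regular sequence of length `r`. -/
theorem exists_isRegular_quotSMulTop {r : ℕ} {M : Type*} [AddCommGroup M] [Module A M]
    [Module.Finite A M] (h : ∃ rs : List A, IsRegular M rs ∧ rs.length = r + 1) {y : A}
    (hym : y ∈ maximalIdeal A) (hy : IsSMulRegular M y) :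
    ∃ rs : List A, IsRegular (QuotSMulTop y M) rs ∧ rs.length = r := by
  induction r generalizing M y with
  | zero =>
    obtain ⟨rs, hrs, -⟩ := h
    have := hrs.nontrivial
    have := nontrivial_quotSMulTop_of_mem_maximalIdeal M hym
    exact ⟨[], IsRegular.nil _ _, rfl⟩
  | succ r ih =>
    obtain ⟨rs, hrs, hlen⟩ := h
    match rs, hlen with
    | x :: x' :: rs, hlen =>
      have hxm := mem_maximalIdeal_of_isRegular_cons hrs
      have hnt := hrs.nontrivial
      rw [isRegular_cons_iff] at hrs
      have hxm' := mem_maximalIdeal_of_isRegular_cons hrs.2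
      have hx' := ((isRegular_cons_iff _ _ _).1 hrs.2).1
      have h1 : maximalIdeal A ∉ associatedPrimes A (QuotSMulTop x M) := fun hm =>
        isSMulRegular_iff_forall_notMem_associatedPrimes.1 hx' _ hm hxm'
      have h2 : maximalIdeal A ∉ associatedPrimes A (QuotSMulTop y M) := fun hm =>
        h1 (maximalIdeal_mem_associatedPrimes_quotSMulTop hrs.1 hy hxm hm)
      obtain ⟨z, hzm, hz1, hz2⟩ := exists_mem_maximalIdeal_isSMulRegular h1 h2
      -- `[x, z]` and `[y, z]` are regular on `M`, hence so are their permutations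
      have swap : ∀ t ∈ maximalIdeal A, IsSMulRegular M t → IsSMulRegular (QuotSMulTop t M) z →
          IsSMulRegular M z ∧ IsSMulRegular (QuotSMulTop z M) t := by
        intro t htm ht htz
        have hw : IsWeaklyRegular M [t, z] := by simp [ht, htz]
        have := isWeaklyRegular_of_perm_of_subset_maximalIdeal hw (List.Perm.swap z t [])
          (by rintro a (_ | ⟨_, _ | ⟨_, h⟩⟩); exacts [htm, hzm, absurd h List.not_mem_nil])
        simpa using this
      obtain ⟨hzM, hxz⟩ := swap x hxm hrs.1 hz1
      obtain ⟨-, hyz⟩ := swap y hym hy hz2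
      obtain ⟨rs₁, hrs₁, hlen₁⟩ := ih ⟨_, hrs.2, by simpa using hlen⟩ hzm hz1
      have hreg : IsRegular M (z :: x :: rs₁) := by
        have : IsRegular M (x :: z :: rs₁) := by
          rw [isRegular_cons_iff, isRegular_cons_iff]
          exact ⟨hrs.1, hz1, hrs₁⟩
        exact isRegular_of_perm this (List.Perm.swap z x rs₁)
      rw [isRegular_cons_iff] at hreg
      obtain ⟨rs₂, hrs₂, hlen₂⟩ := ih ⟨_, hreg.2, by simp [hlen₁]⟩ hym hyz
      have hreg2 : IsRegular M (y :: z :: rs₂) := by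
        have : IsRegular M (z :: y :: rs₂) := by
          rw [isRegular_cons_iff, isRegular_cons_iff]
          exact ⟨hzM, hyz, hrs₂⟩
        exact isRegular_of_perm this (List.Perm.swap y z rs₂)
      rw [isRegular_cons_iff] at hreg2
      exact ⟨z :: rs₂, hreg2.2, by simp [hlen₂]⟩

theorem supportDim_le_supportDim_quotient_ofList_add_length {M : Type*} [AddCommGroup M]
    [Module A M] [Module.Finite A M] {fs : List A} (hfs : ∀ f ∈ fs, f ∈ maximalIdeal A) :
    Module.supportDim A M ≤
      Module.supportDim A (M ⧸ (Ideal.ofList fs • ⊤ : Submodule A M)) + fs.length := by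
  induction fs generalizing M with
  | nil =>
    rw [Module.supportDim_eq_of_equiv
      (Submodule.quotEquivOfEqBot (Ideal.ofList [] • ⊤ : Submodule A M) (by simp))]
    simp
  | cons f fs ih =>
    rw [Module.supportDim_eq_of_equiv (Submodule.quotOfListConsSMulTopEquivQuotSMulTopInner M f fs)]
    have h1 := Module.supportDim_le_supportDim_quotSMulTop_succ (M := M)
      (hfs f List.mem_cons_self)
    have h2 := ih (M := QuotSMulTop f M) fun g hg => hfs g (List.mem_cons_of_mem _ hg)
    refine h1.trans ((add_le_add_left h2 1).trans_eq ?_)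
    simp [add_assoc]

/-- In a module of depth at least `N + r`, any `r` elements that cut the dimension down to `N` form
a regular sequence, and the quotient still has a regular sequence of length `N`. -/
theorem isRegular_of_supportDim_le {N : ℕ} {M : Type*} [AddCommGroup M] [Module A M]
    [Module.Finite A M] {fs : List A} (hfs : ∀ f ∈ fs, f ∈ maximalIdeal A)
    (hM : ∃ rs : List A, IsRegular M rs ∧ rs.length = N + fs.length)
    (hdim : Module.supportDim A (M ⧸ (Ideal.ofList fs • ⊤ : Submodule A M)) ≤ N) :
    IsRegular M fs ∧ ∃ rs : List A,
      IsRegular (M ⧸ (Ideal.ofList fs • ⊤ : Submodule A M)) rs ∧ rs.length = N := by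
  induction fs generalizing M with
  | nil =>
    obtain ⟨rs, hrs, hlen⟩ := hM
    have := hrs.nontrivial
    exact ⟨IsRegular.nil _ _, rs, ((Submodule.quotEquivOfEqBot
      (Ideal.ofList [] • ⊤ : Submodule A M) (by simp)).isRegular_congr rs).2 hrs,
      by simpa using hlen⟩
  | cons f fs ih =>
    have hfm := hfs f List.mem_cons_self
    have hfs' : ∀ g ∈ fs, g ∈ maximalIdeal A := fun g hg => hfs g (List.mem_cons_of_mem _ hg)
    have hf : IsSMulRegular M f := by
      rw [isSMulRegular_iff_forall_notMem_associatedPrimes]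
      intro p hp hfp
      have hpp := hp.isPrime
      obtain ⟨rs, hrs, hlen⟩ := hM
      have h1 := length_le_ringKrullDim_of_mem_associatedPrimes hrs hp
      rw [← Module.supportDim_quotient_eq_ringKrullDim] at h1
      have h2 := supportDim_le_supportDim_quotient_ofList_add_length (M := A ⧸ p) hfs'
      have h3 : Module.supportDim A ((A ⧸ p) ⧸ (Ideal.ofList fs • ⊤ : Submodule A (A ⧸ p))) ≤
          Module.supportDim A (M ⧸ (Ideal.ofList (f :: fs) • ⊤ : Submodule A M)) := by
        have hsub : Module.support A ((A ⧸ p) ⧸ (Ideal.ofList fs • ⊤ : Submodule A (A ⧸ p))) ⊆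
            Module.support A (M ⧸ (Ideal.ofList (f :: fs) • ⊤ : Submodule A M)) := by
          rw [Module.support_quotient, Module.support_quotient, Module.support_eq_zeroLocus,
            Module.support_eq_zeroLocus, Ideal.annihilator_quotient]
          rintro q ⟨hq1, hq2⟩
          rw [PrimeSpectrum.mem_zeroLocus, SetLike.coe_subset_coe] at hq1 hq2
          constructor
          · rw [PrimeSpectrum.mem_zeroLocus, SetLike.coe_subset_coe]
            rw [← Submodule.annihilator_top]
            exact hp.annihilator_le.trans hq1
          · rw [PrimeSpectrum.mem_zeroLocus, SetLike.coe_subset_coe, Ideal.ofList_cons, sup_le_iff,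
              Ideal.span_singleton_le_iff_mem]
            exact ⟨hq1 hfp, hq2⟩
        exact Order.krullDim_le_of_strictMono (Set.inclusion hsub) fun _ _ h => h
      have h4 : ((N + fs.length + 1 : ℕ) : WithBot ℕ∞) ≤ ((N + fs.length : ℕ) : WithBot ℕ∞) := by
        calc ((N + fs.length + 1 : ℕ) : WithBot ℕ∞) = rs.length := by rw [hlen]; rfl
          _ ≤ _ := h1
          _ ≤ _ := h2
          _ ≤ (N : WithBot ℕ∞) + fs.length := by gcongr; exact h3.trans hdim
          _ = _ := by push_cast; rfl
      have := Nat.cast_le.1 h4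
      omega
    obtain ⟨rs, hrs, hlen⟩ := exists_isRegular_quotSMulTop (r := N + fs.length) hM hfm hf
    let e := Submodule.quotOfListConsSMulTopEquivQuotSMulTopInner M f fs
    obtain ⟨h1, rs', hrs', hlen'⟩ := ih (M := QuotSMulTop f M) hfs' ⟨rs, hrs, hlen⟩
      (by rwa [← Module.supportDim_eq_of_equiv e])
    exact ⟨(isRegular_cons_iff _ _ _).2 ⟨hf, h1⟩, rs', (e.isRegular_congr rs').2 hrs', hlen'⟩

end Depth

/-! ### Homogeneous ideals -/

section Homogeneous

attribute [local instance] MvPolynomial.gradedAlgebra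

theorem homogeneousComponent_mul {σ k : Type*} [CommSemiring k] (d : ℕ) (s g : MvPolynomial σ k) :
    homogeneousComponent d (s * g) = ∑ ij ∈ Finset.HasAntidiagonal.antidiagonal d,
      homogeneousComponent ij.1 s * homogeneousComponent ij.2 g := by
  classical
  have key : ∀ (e : ℕ) (f : MvPolynomial σ k),
      (DirectSum.decompose (homogeneousSubmodule σ k) f e : MvPolynomial σ k) =
        homogeneousComponent e f := fun e f => decomposition.decompose'_apply f e
  rw [← key, DirectSum.decompose_mul, DirectSum.coe_mul_apply_eq_sum_antidiagonal]
  exact Finset.sum_congr rfl fun x _ => by rw [key, key]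

/-- A homogeneous ideal is saturated with respect to polynomials with nonzero constant term, so it
is determined by its localization at the origin. -/
theorem mem_of_mul_mem_of_coeff_zero_ne_zero {σ k : Type*} [Field k]
    {I : Ideal (MvPolynomial σ k)} (hI : I.IsHomogeneous (homogeneousSubmodule σ k))
    {s g : MvPolynomial σ k} (hs : coeff 0 s ≠ 0) (h : s * g ∈ I) : g ∈ I := by
  rw [mem_iff_homogeneousComponent_mem hI]
  intro d
  induction d using Nat.strong_induction_on with
  | _ d ih =>
    have h1 := homogeneousComponent_mem_of_mem hI h d
    rw [homogeneousComponent_mul, ← Finset.add_sum_erase _ _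
      (show (0, d) ∈ Finset.HasAntidiagonal.antidiagonal d by simp)] at h1
    have h2 : ∑ x ∈ (Finset.HasAntidiagonal.antidiagonal d).erase (0, d),
        homogeneousComponent x.1 s * homogeneousComponent x.2 g ∈ I := by
      refine Ideal.sum_mem _ fun x hx => Ideal.mul_mem_left _ _ (ih _ ?_)
      rw [Finset.mem_erase, Finset.HasAntidiagonal.mem_antidiagonal] at hx
      have : x.1 ≠ 0 := by
        intro h0
        apply hx.1
        ext <;> simp <;> omega
      omega
    have h3 := (I.add_mem_iff_left h2).1 h1
    rw [homogeneousComponent_zero] at h3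
    have := I.mul_mem_left (C (coeff 0 s)⁻¹) h3
    rwa [← mul_assoc, ← C_mul, inv_mul_cancel₀ hs, C_1, one_mul] at this

end Homogeneous

/-! ### The coordinates as a regular sequence -/

section PolynomialRing

open RingTheory.Sequence

variable {σ k : Type*} [Field k]

theorem isWeaklyRegular_map_X {l : List σ} (hl : l.Nodup) :
    IsWeaklyRegular (MvPolynomial σ k) (l.map (X : σ → MvPolynomial σ k)) := by
  classical
  refine ⟨fun i hi => ?_⟩
  rw [List.length_map] at hi
  rw [isSMulRegular_quotient_iff_mem_of_smul_mem]
  intro f hf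
  have hI : (Ideal.ofList ((l.map (X : σ → MvPolynomial σ k)).take i) • ⊤ :
      Submodule (MvPolynomial σ k) (MvPolynomial σ k)) =
      Ideal.span ((X : σ → MvPolynomial σ k) '' {a | a ∈ l.take i}) := by
    rw [smul_eq_mul, Ideal.mul_top]
    change Ideal.span _ = _
    congr 1
    ext f
    simp [← List.map_take]
  rw [hI, mem_ideal_span_X_image] at hf ⊢
  intro m hm
  rw [List.getElem_map, smul_eq_mul] at hf
  obtain ⟨a, ha, hne⟩ := hf (Finsupp.single l[i] 1 + m) (by
    rw [mem_support_iff, coeff_X_mul]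
    exact mem_support_iff.1 hm)
  refine ⟨a, ha, ?_⟩
  have hai : l[i] ≠ a := by
    rintro rfl
    obtain ⟨j, hj, hj'⟩ := List.mem_iff_getElem.1 ha
    rw [List.getElem_take] at hj'
    have := (List.Nodup.getElem_inj_iff hl).1 hj'
    rw [List.length_take] at hj
    omega
  rw [Finsupp.add_apply, Finsupp.single_eq_of_ne' hai, zero_add] at hne
  exact hne

theorem isWeaklyRegular_map_X_sub_C (a : σ → k) {l : List σ} (hl : l.Nodup) :
    IsWeaklyRegular (MvPolynomial σ k) (l.map fun i => X i - C (a i)) := by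
  let τ : MvPolynomial σ k ≃ₐ[k] MvPolynomial σ k :=
    AlgEquiv.ofAlgHom (aeval fun i => X i - C (a i)) (aeval fun i => X i + C (a i))
      (by ext i; simp [← algebraMap_eq]) (by ext i; simp [← algebraMap_eq])
  refine (AddEquiv.isWeaklyRegular_congr (e := (τ : MvPolynomial σ k ≃+ MvPolynomial σ k)) ?_).1
    (isWeaklyRegular_map_X (k := k) hl)
  rw [List.forall₂_map_left_iff, List.forall₂_map_right_iff, List.forall₂_same]
  intro i _ f
  change τ (X i * f) = (X i - C (a i)) * τ f
  rw [map_mul]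
  simp [τ]

/-- The local ring of affine space at a closed point has a regular sequence of the expected
length, the coordinates centred at that point. -/
theorem exists_isRegular_localization [Finite σ] [IsAlgClosed k] (m : Ideal (MvPolynomial σ k))
    [hm : m.IsMaximal] : ∃ rs : List (Localization.AtPrime m),
      IsRegular (Localization.AtPrime m) rs ∧ rs.length = Nat.card σ := by
  have := Fintype.ofFinite σ
  obtain ⟨a, ha⟩ := isMaximal_iff_eq_vanishingIdeal_singleton.1 hm
  refine ⟨_, (isWeaklyRegular_map_X_sub_C a
    (Finset.nodup_toList (Finset.univ : Finset σ))).isRegular_of_isLocalization_of_mem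
      (Localization.AtPrime m) m ?_, by simp⟩
  intro r hr
  obtain ⟨i, -, rfl⟩ := List.mem_map.1 hr
  rw [ha, mem_vanishingIdeal_singleton_iff]
  simp

end PolynomialRing

/-! ### Dimension and localization -/

section Localization

variable {R : Type*} [CommRing R]

theorem ringKrullDim_localization_quotient_le (p : Ideal R) [p.IsPrime] (I : Ideal R) :
    ringKrullDim (Localization.AtPrime p ⧸ I.map (algebraMap R (Localization.AtPrime p))) ≤
      ringKrullDim (R ⧸ I) := by
  rw [ringKrullDim_quotient, ringKrullDim_quotient]
  have hmem : ∀ q : PrimeSpectrum (Localization.AtPrime p),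
      q ∈ PrimeSpectrum.zeroLocus (I.map (algebraMap R (Localization.AtPrime p)) : Set _) →
      q.comap (algebraMap R _) ∈ PrimeSpectrum.zeroLocus (I : Set R) := by
    intro q hq
    rw [PrimeSpectrum.mem_zeroLocus, SetLike.coe_subset_coe] at hq ⊢
    exact Ideal.map_le_iff_le_comap.1 hq
  refine Order.krullDim_le_of_strictMono
    (fun q => ⟨q.1.comap (algebraMap R (Localization.AtPrime p)), hmem _ q.2⟩) ?_
  refine Monotone.strictMono_of_injective (fun q q' h => ?_) (fun q q' h => ?_)
  · exact Ideal.comap_mono h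
  · exact Subtype.ext (PrimeSpectrum.localization_comap_injective _ p.primeCompl
      (congrArg Subtype.val h))

end Localization

/-! ### Ideals of the expected dimension in polynomial rings -/

section CompleteIntersection

open RingTheory.Sequence

variable {σ k : Type*} [Finite σ] [Field k] [IsAlgClosed k]

/-- If `fs` cuts out a subscheme of affine space whose dimension is at most the expected one, then
it is a regular sequence locally at each closed point of this subscheme. -/
theorem isRegular_localization_of_ringKrullDim_le {D : ℕ} {fs : List (MvPolynomial σ k)}
    (hcard : Nat.card σ = D + fs.length)
    (hdim : ringKrullDim (MvPolynomial σ k ⧸ Ideal.ofList fs) ≤ D)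
    (m : Ideal (MvPolynomial σ k)) [hm : m.IsMaximal] (hfs : ∀ f ∈ fs, f ∈ m) :
    let A := Localization.AtPrime m
    IsRegular A (fs.map (algebraMap _ A)) ∧ ∃ rs : List A,
      IsRegular (A ⧸ (Ideal.ofList fs).map (algebraMap _ A)) rs ∧ rs.length = D := by
  intro A
  have hsmul : (Ideal.ofList (fs.map (algebraMap (MvPolynomial σ k) A)) • ⊤ : Submodule A A) =
      (Ideal.ofList fs).map (algebraMap (MvPolynomial σ k) A) := by
    rw [smul_eq_mul, Ideal.mul_top, Ideal.map_ofList]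
  obtain ⟨rs, hrs, hlen⟩ := exists_isRegular_localization m
  have := isRegular_of_supportDim_le (A := A) (M := A) (N := D)
    (fs := fs.map (algebraMap _ A)) ?_ ⟨rs, hrs, by simp [hlen, hcard]⟩ ?_
  · rwa [hsmul] at this
  · intro g hg
    obtain ⟨f, hf, rfl⟩ := List.mem_map.1 hg
    exact (IsLocalization.AtPrime.to_map_mem_maximal_iff A m f).2 (hfs f hf)
  · rw [hsmul, Module.supportDim_quotient_eq_ringKrullDim]
    exact (ringKrullDim_localization_quotient_le m _).trans hdim

attribute [local instance] MvPolynomial.gradedAlgebra in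
/-- Homogeneous polynomials of positive degree that cut out a subscheme of at most the expected
dimension form a regular sequence. -/
theorem isRegular_of_isHomogeneous_of_ringKrullDim_le {D : ℕ} {fs : List (MvPolynomial σ k)}
    (hcard : Nat.card σ = D + fs.length)
    (hdim : ringKrullDim (MvPolynomial σ k ⧸ Ideal.ofList fs) ≤ D)
    (hhom : ∀ f ∈ fs, ∃ d ≠ 0, f.IsHomogeneous d) : IsRegular (MvPolynomial σ k) fs := by
  let m : Ideal (MvPolynomial σ k) := vanishingIdeal k {(0 : σ → k)}
  have hfm : ∀ f ∈ fs, f ∈ m := by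
    intro f hf
    obtain ⟨d, hd, hfd⟩ := hhom f hf
    rw [mem_vanishingIdeal_singleton_iff]
    have : constantCoeff f = 0 := by
      rw [constantCoeff_eq]
      exact hfd.coeff_eq_zero (by simpa using hd.symm)
    rw [← this, aeval_zero]
    rfl
  obtain ⟨hreg, -⟩ := isRegular_localization_of_ringKrullDim_le hcard hdim m hfm
  refine ⟨⟨fun i hi => ?_⟩, ?_⟩
  · have hsmul (T : Type _) [CommRing T] (l : List T) :
        (Ideal.ofList l • ⊤ : Ideal T) = Ideal.ofList l := by
      simp
    have h1 := hreg.1.regular_mod_prev i (by simpa using hi)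
    rw [isSMulRegular_quotient_iff_mem_of_smul_mem] at h1 ⊢
    intro g hg
    rw [hsmul] at hg ⊢
    have h2 := h1 (algebraMap _ _ g) (by
      rw [hsmul, ← List.map_take, ← Ideal.map_ofList, List.getElem_map, smul_eq_mul, ← map_mul]
      exact Ideal.mem_map_of_mem _ hg)
    rw [hsmul, ← List.map_take, ← Ideal.map_ofList] at h2
    rw [IsLocalization.algebraMap_mem_map_algebraMap_iff m.primeCompl] at h2
    obtain ⟨s, hs, hsg⟩ := h2
    refine mem_of_mul_mem_of_coeff_zero_ne_zero ?_ (s := s) ?_ hsg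
    · refine Ideal.homogeneous_span _ _ fun f hf => ?_
      obtain ⟨d, -, hfd⟩ := hhom f (List.mem_of_mem_take hf)
      exact ⟨d, hfd⟩
    · intro h0
      refine hs ?_
      rw [SetLike.mem_coe, mem_vanishingIdeal_singleton_iff, ← h0, ← constantCoeff_eq,
        aeval_zero]
      rfl
  · rw [smul_eq_mul, Ideal.mul_top]
    intro h
    have : Ideal.ofList fs ≤ m := Ideal.span_le.2 hfm
    rw [← h] at this
    exact (inferInstance : m.IsMaximal).ne_top (top_le_iff.1 this)

/-- Unmixedness: a subscheme of affine space of at most the expected dimension has no associated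
prime of smaller dimension. -/
theorem le_ringKrullDim_of_mem_associatedPrimes {D : ℕ} {fs : List (MvPolynomial σ k)}
    (hcard : Nat.card σ = D + fs.length)
    (hdim : ringKrullDim (MvPolynomial σ k ⧸ Ideal.ofList fs) ≤ D) {P : Ideal (MvPolynomial σ k)}
    (hP : P ∈ associatedPrimes (MvPolynomial σ k) (MvPolynomial σ k ⧸ Ideal.ofList fs)) :
    (D : WithBot ℕ∞) ≤ ringKrullDim (MvPolynomial σ k ⧸ P) := by
  have hPp := hP.isPrime
  obtain ⟨m, hm, hPm⟩ := P.exists_le_maximal hPp.ne_top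
  have hIP : Ideal.ofList fs ≤ P := by
    have := hP.annihilator_le
    rwa [Submodule.annihilator_top, Ideal.annihilator_quotient] at this
  obtain ⟨-, rs, hrs, hlen⟩ := isRegular_localization_of_ringKrullDim_le hcard hdim m
    (fun f hf => hPm (hIP (Ideal.subset_span hf)))
  have hdisj : Disjoint (m.primeCompl : Set (MvPolynomial σ k)) P :=
    Set.disjoint_left.2 fun x hx hxP => hx (hPm hxP)
  let A := Localization.AtPrime m
  let I : Ideal (MvPolynomial σ k) := Ideal.ofList fs
  have hmem : P.map (algebraMap _ A) ∈ associatedPrimes A (A ⧸ I.map (algebraMap _ A)) := by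
    obtain ⟨xb, hx⟩ := (isAssociatedPrime_iff.1 hP).2
    obtain ⟨x, rfl⟩ := Ideal.Quotient.mk_surjective xb
    have hx' : ∀ a, a ∈ P ↔ a * x ∈ I := by
      intro a
      rw [hx, Submodule.mem_colon_singleton, Submodule.mem_bot, ← Ideal.Quotient.eq_zero_iff_mem,
        map_mul]
      rfl
    refine isAssociatedPrime_iff.2 ⟨IsLocalization.isPrime_of_isPrime_disjoint m.primeCompl A P
      hPp hdisj, Ideal.Quotient.mk _ (algebraMap _ A x), ?_⟩
    ext b
    obtain ⟨a, s, rfl⟩ := IsLocalization.exists_mk'_eq m.primeCompl b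
    have h1 : IsLocalization.mk' A a s • (Ideal.Quotient.mk (I.map (algebraMap _ A))
        (algebraMap _ A x)) = Ideal.Quotient.mk _ (IsLocalization.mk' A (a * x) s) := by
      have : IsLocalization.mk' A (a * x) s = IsLocalization.mk' A a s * algebraMap _ A x := by
        rw [mul_comm a x, ← IsLocalization.mul_mk'_eq_mk'_of_mul, mul_comm]
      rw [this]
      rfl
    rw [Submodule.mem_colon_singleton, Submodule.mem_bot, h1, Ideal.Quotient.eq_zero_iff_mem,
      IsLocalization.mk'_mem_map_algebraMap_iff, IsLocalization.mk'_mem_map_algebraMap_iff]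
    refine exists_congr fun u => and_congr_right fun _ => ?_
    rw [hx', mul_assoc]
  have := length_le_ringKrullDim_of_mem_associatedPrimes hrs hmem
  rw [hlen] at this
  exact this.trans (ringKrullDim_localization_quotient_le m P)

end CompleteIntersection

/-! ### Derivations and dimension -/

section Derivations

open scoped TensorProduct

theorem formallyEtale_of_isAlgebraic (A L : Type*) [CommRing A] [IsDomain A] [Field L] [CharZero L]
    [Algebra A L] [FaithfulSMul A L] [Algebra.IsAlgebraic A L] : Algebra.FormallyEtale A L := by
  let := FractionRing.liftAlgebra A L
  have : IsScalarTower A (FractionRing A) L := FractionRing.isScalarTower_liftAlgebra A L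
  have : CharZero (FractionRing A) :=
    ((algebraMap (FractionRing A) L).charZero_iff (algebraMap (FractionRing A) L).injective).2 ‹_›
  have : Algebra.IsAlgebraic (FractionRing A) L :=
    ⟨fun x => (IsFractionRing.isAlgebraic_iff A (FractionRing A) L).1
      (Algebra.IsAlgebraic.isAlgebraic x)⟩
  have : Algebra.FormallyEtale (FractionRing A) L := Algebra.FormallyEtale.of_isSeparable _ L
  have : Algebra.FormallyEtale A (FractionRing A) :=
    Algebra.FormallyEtale.of_isLocalization (nonZeroDivisors A)
  exact Algebra.FormallyEtale.comp A (FractionRing A) L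

theorem ringKrullDim_le_of_isIntegral {A B : Type*} [CommRing A] [CommRing B] [Algebra A B]
    [Algebra.IsIntegral A B] : ringKrullDim B ≤ ringKrullDim A :=
  Order.krullDim_le_of_strictMono (PrimeSpectrum.comap (algebraMap A B))
    fun p q h => Ideal.IsIntegral.comap_lt_comap (I := p.asIdeal) (J := q.asIdeal) h

/-- The dimension of a domain of finite type over `k` is bounded by the number of independent
derivations of an algebraic extension of its fraction field. By Noether normalization this field is
formally étale over a polynomial ring. -/
theorem ringKrullDim_le_finrank_derivation (k B L : Type*) [Field k] [CommRing B] [IsDomain B]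
    [Algebra k B] [Algebra.FiniteType k B] [Field L] [CharZero L] [Algebra k L] [Algebra B L]
    [IsScalarTower k B L] [FaithfulSMul B L] [Algebra.IsAlgebraic B L] :
    Module.Finite L (Derivation k L L) ∧
      ringKrullDim B ≤ (Module.finrank L (Derivation k L L) : WithBot ℕ∞) := by
  obtain ⟨s, g, hinj, hint⟩ := exists_integral_inj_algHom_of_fg k B
  let := g.toRingHom.toAlgebra
  have htow : IsScalarTower k (MvPolynomial (Fin s) k) B :=
    IsScalarTower.of_algebraMap_eq fun x => by
    exact (g.commutes x).symm
  have : Algebra.IsIntegral (MvPolynomial (Fin s) k) B := ⟨hint⟩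
  let := ((algebraMap B L).comp g.toRingHom).toAlgebra
  have : IsScalarTower (MvPolynomial (Fin s) k) B L := IsScalarTower.of_algebraMap_eq fun x => rfl
  have : IsScalarTower k (MvPolynomial (Fin s) k) L := IsScalarTower.of_algebraMap_eq fun x => by
    rw [IsScalarTower.algebraMap_apply k B L,
      IsScalarTower.algebraMap_apply k (MvPolynomial (Fin s) k) B]
    rfl
  have : FaithfulSMul (MvPolynomial (Fin s) k) L := by
    rw [faithfulSMul_iff_algebraMap_injective]
    exact (FaithfulSMul.algebraMap_injective B L).comp hinj
  have : FaithfulSMul (MvPolynomial (Fin s) k) B := by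
    rw [faithfulSMul_iff_algebraMap_injective]
    exact hinj
  have : Algebra.IsAlgebraic (MvPolynomial (Fin s) k) L :=
    Algebra.IsAlgebraic.trans (MvPolynomial (Fin s) k) B L
  have := formallyEtale_of_isAlgebraic (MvPolynomial (Fin s) k) L
  let b : Module.Basis (Fin s) L (Ω[L⁄k]) :=
    ((KaehlerDifferential.mvPolynomialBasis k (Fin s)).baseChange L).map
      (KaehlerDifferential.tensorKaehlerEquivOfFormallyEtale k (MvPolynomial (Fin s) k) L)
  let e : (Ω[L⁄k] →ₗ[L] L) ≃ₗ[L] Derivation k L L :=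
    KaehlerDifferential.linearMapEquivDerivation k L
  have hfin : Module.Finite L (Ω[L⁄k]) := Module.Finite.of_basis b
  refine ⟨Module.Finite.equiv e, ?_⟩
  have hrank : Module.finrank L (Derivation k L L) = s := by
    rw [← e.finrank_eq, Module.finrank_linearMap_self, Module.finrank_eq_card_basis b,
      Fintype.card_fin]
  rw [hrank]
  refine (ringKrullDim_le_of_isIntegral (A := MvPolynomial (Fin s) k)).trans_eq ?_
  rw [MvPolynomial.ringKrullDim_of_isNoetherianRing, ringKrullDim_eq_zero_of_field]
  simp

theorem derivation_eq_zero_of_isAlgebraic {k B L : Type*} [Field k] [CommRing B] [IsDomain B]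
    [Algebra k B] [Field L] [CharZero L] [Algebra k L] [Algebra B L]
    [IsScalarTower k B L] [FaithfulSMul B L] [Algebra.IsAlgebraic B L] (D : Derivation k L L)
    (h : ∀ b, D (algebraMap B L b) = 0) : D = 0 := by
  have := formallyEtale_of_isAlgebraic B L
  let D' : Derivation B L L :=
    Derivation.mk'
      { toFun := D
        map_add' := map_add D
        map_smul' := fun b x => by
          rw [Algebra.smul_def, D.leibniz, h, smul_zero, add_zero, RingHom.id_apply,
            algebraMap_smul] } D.leibniz
  have hsub : Subsingleton (Derivation B L L) :=
    (KaehlerDifferential.linearMapEquivDerivation B L).symm.toEquiv.subsingleton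
  have h0 : D' = 0 := Subsingleton.elim _ _
  ext x
  exact Derivation.congr_fun h0 x

end Derivations

/-! ### Simultaneous triangularization -/

section Invariant

variable {L V : Type*} [Field L] [AddCommGroup V] [Module L V]

/-- Two endomorphisms whose commutator has rank at most one leave a proper nonzero subspace
invariant: the kernel or the image of `X - a` for an eigenvalue `a` of `X`. Such a subspace
either lies in the kernel of `j` or contains `i`. -/
theorem exists_invariant_submodule [IsAlgClosed L] [FiniteDimensional L V]
    (hdim : 2 ≤ Module.finrank L V) (X Y : Module.End L V) (i : V) (j : Module.Dual L V)
    (h : ∀ v, X (Y v) - Y (X v) + j v • i = 0) :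
    ∃ U : Submodule L V, U ≠ ⊥ ∧ U ≠ ⊤ ∧ (∀ u ∈ U, X u ∈ U) ∧ (∀ u ∈ U, Y u ∈ U) ∧
      ((∀ u ∈ U, j u = 0) ∨ i ∈ U) := by
  have hnt : Nontrivial V := Module.nontrivial_of_finrank_pos (R := L) (by omega)
  -- every common invariant subspace satisfies the last condition
  suffices ∃ U : Submodule L V, U ≠ ⊥ ∧ U ≠ ⊤ ∧ (∀ u ∈ U, X u ∈ U) ∧ (∀ u ∈ U, Y u ∈ U) by
    obtain ⟨U, h1, h2, h3, h4⟩ := this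
    refine ⟨U, h1, h2, h3, h4, ?_⟩
    by_contra! hcon
    obtain ⟨⟨u, hu, hju⟩, hi⟩ := hcon
    apply hi
    have h5 : j u • i ∈ U := by
      rw [eq_neg_of_add_eq_zero_right (h u)]
      exact U.neg_mem (U.sub_mem (h3 _ (h4 _ hu)) (h4 _ (h3 _ hu)))
    exact (U.smul_mem_iff hju).1 h5
  have eigen : ∀ Z : Module.End L V, ∃ a : L, ∃ v ≠ 0, Z v = a • v := by
    intro Z
    obtain ⟨a, ha⟩ := Module.End.exists_eigenvalue Z
    obtain ⟨v, hv⟩ := ha.exists_hasEigenvector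
    exact ⟨a, v, hv.2, hv.apply_eq_smul⟩
  obtain ⟨a, v, hv0, hv⟩ := eigen X
  by_cases hX : ∀ w, X w = a • w
  · obtain ⟨b, u, hu0, hu⟩ := eigen Y
    refine ⟨Submodule.span L {u}, by simpa using hu0, ?_, ?_, ?_⟩
    · intro htop
      have := finrank_span_singleton (K := L) hu0
      rw [htop, finrank_top] at this
      omega
    · intro w hw
      rw [hX]
      exact Submodule.smul_mem _ _ hw
    · intro w hw
      obtain ⟨c, rfl⟩ := Submodule.mem_span_singleton.1 hw
      rw [map_smul, hu, smul_comm]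
      exact Submodule.smul_mem _ _ hw
  push Not at hX
  obtain ⟨w, hw⟩ := hX
  let Z : Module.End L V := X - a • LinearMap.id
  have hZ : ∀ v, Z v = X v - a • v := fun v => rfl
  have hcomm : ∀ v, Y (Z v) = Z (Y v) + j v • i := by
    intro v
    rw [hZ, hZ, map_sub, map_smul, ← sub_eq_zero, ← neg_eq_zero, ← h v]
    abel
  by_cases hK : ∀ u, Z u = 0 → Z (Y u) = 0
  · refine ⟨LinearMap.ker Z, ?_, ?_, ?_, fun u hu => hK u hu⟩
    · intro hbot
      have : v ∈ LinearMap.ker Z := by rw [LinearMap.mem_ker, hZ, hv, sub_self]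
      rw [hbot] at this
      exact hv0 this
    · intro htop
      have : w ∈ LinearMap.ker Z := htop ▸ trivial
      rw [LinearMap.mem_ker, hZ, sub_eq_zero] at this
      exact hw this
    · intro u hu
      rw [LinearMap.mem_ker, hZ, sub_eq_zero] at hu
      rw [hu]
      exact Submodule.smul_mem _ _ (by rw [LinearMap.mem_ker, hZ, hu, sub_self])
  · push Not at hK
    obtain ⟨u, hu, hYu⟩ := hK
    have hi : i ∈ LinearMap.range Z := by
      have h1 := hcomm u
      rw [hu, map_zero] at h1
      have hju : j u ≠ 0 := by
        intro h0
        rw [h0, zero_smul, add_zero] at h1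
        exact hYu h1.symm
      have h2 : j u • i ∈ LinearMap.range Z := by
        rw [eq_neg_of_add_eq_zero_right h1.symm]
        exact Submodule.neg_mem _ (LinearMap.mem_range_self _ _)
      exact (Submodule.smul_mem_iff _ hju).1 h2
    refine ⟨LinearMap.range Z, ?_, ?_, ?_, ?_⟩
    · intro hbot
      have : Z w ∈ LinearMap.range Z := LinearMap.mem_range_self _ _
      rw [hbot, Submodule.mem_bot, hZ, sub_eq_zero] at this
      exact hw this
    · intro htop
      have hinj := LinearMap.injective_iff_surjective.2 (LinearMap.range_eq_top.1 htop)
      refine hv0 (hinj ?_)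
      rw [map_zero, hZ, hv, sub_self]
    · rintro _ ⟨t, rfl⟩
      have : X (Z t) = Z (Z t) + a • Z t := by rw [hZ (Z t)]; abel
      rw [this]
      exact Submodule.add_mem _ (LinearMap.mem_range_self _ _)
        (Submodule.smul_mem _ _ (LinearMap.mem_range_self _ _))
    · rintro _ ⟨t, rfl⟩
      rw [hcomm]
      exact Submodule.add_mem _ (LinearMap.mem_range_self _ _) (Submodule.smul_mem _ _ hi)

/-- Two endomorphisms with `[X, Y] + i j = 0` are simultaneously triangular in some basis, in which
the supports of `i` and `j` are disjoint. The predicate `s` marks the indices where `i` may be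
nonzero. -/
theorem exists_basis_triangular {L : Type*} [Field L] [IsAlgClosed L] (d : ℕ) {V : Type*}
    [AddCommGroup V] [Module L V] [FiniteDimensional L V] (hd : Module.finrank L V = d)
    (X Y : Module.End L V) (i : V)
    (j : Module.Dual L V) (h : ∀ v, X (Y v) - Y (X v) + j v • i = 0) :
    ∃ (ι : Type) (_ : Fintype ι) (_ : LinearOrder ι) (b : Module.Basis ι L V) (s : ι → Prop),
      (∀ r t, t < r → b.repr (X (b t)) r = 0) ∧ (∀ r t, t < r → b.repr (Y (b t)) r = 0) ∧
      (∀ r, ¬ s r → b.repr i r = 0) ∧ (∀ r, s r → j (b r) = 0) := by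
  induction d using Nat.strong_induction_on generalizing V with
  | _ d ih =>
    rcases Nat.lt_or_ge d 2 with hlt | hge
    · let b := Module.finBasisOfFinrankEq L V hd
      have : Subsingleton (Fin d) := by
        rw [Fin.subsingleton_iff_le_one]; omega
      have hij : i = 0 ∨ ∀ v, j v = 0 := by
        by_contra! hcon
        obtain ⟨hi, v, hv⟩ := hcon
        have h1 : d = 1 := by
          have : Nontrivial V := ⟨i, 0, hi⟩
          have := Module.finrank_pos (R := L) (M := V)
          omega
        have scal : ∀ Z : Module.End L V, ∃ c : L, ∀ v, Z v = c • v := by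
          intro Z
          obtain ⟨e, -, he⟩ := finrank_eq_one_iff'.1 (hd.trans h1)
          obtain ⟨c, hc⟩ := he (Z e)
          refine ⟨c, fun v => ?_⟩
          obtain ⟨a, rfl⟩ := he v
          rw [map_smul, ← hc, smul_comm]
        obtain ⟨x, hx⟩ := scal X
        obtain ⟨y, hy⟩ := scal Y
        have h2 := h v
        rw [hx, hy, hx, hy, smul_comm, sub_self, zero_add, smul_eq_zero] at h2
        exact h2.elim hv hi
      refine ⟨Fin d, inferInstance, inferInstance, b, fun _ => i ≠ 0,
        fun r t hrt => absurd (Subsingleton.elim t r) hrt.ne,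
        fun r t hrt => absurd (Subsingleton.elim t r) hrt.ne, fun r hr => ?_, fun r hr => ?_⟩
      · rw [not_not.1 hr]; simp
      · exact hij.resolve_left hr _
    · obtain ⟨U, hbot, htop, hXU, hYU, hU⟩ := exists_invariant_submodule (hd ▸ hge) X Y i j h
      have hU1 : Module.finrank L U < d := hd ▸ Submodule.finrank_lt htop
      have hU2 : Module.finrank L (V ⧸ U) < d := by
        have h1 := U.finrank_quotient_add_finrank
        have h2 : 0 < Module.finrank L U := by
          rw [Module.finrank_pos_iff]
          exact (Submodule.nontrivial_iff_ne_bot).2 hbot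
        omega
      have hX : U ≤ U.comap X := hXU
      have hY : U ≤ U.comap Y := hYU
      -- combine a triangularizing basis of `U` with one of the quotient
      have glue : ∀ (i₁ : U) (j₁ : Module.Dual L U) (i₂ : V ⧸ U) (j₂ : Module.Dual L (V ⧸ U)),
          (∀ u : U, X (Y u) - Y (X u) + j₁ u • (i₁ : V) = 0) →
          (∀ v : V, (Submodule.Quotient.mk (X (Y v) - Y (X v)) : V ⧸ U) +
            j₂ (Submodule.Quotient.mk v) • i₂ = 0) →
          ((∀ u : U, j u = 0) ∧ Submodule.Quotient.mk i = i₂ ∧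
              (∀ v, j v = j₂ (Submodule.Quotient.mk v)) ∨
            ((i₁ : V) = i ∧ ∀ u : U, j u = j₁ u) ) →
          ∃ (ι : Type) (_ : Fintype ι) (_ : LinearOrder ι) (b : Module.Basis ι L V) (s : ι → Prop),
            (∀ r t, t < r → b.repr (X (b t)) r = 0) ∧ (∀ r t, t < r → b.repr (Y (b t)) r = 0) ∧
            (∀ r, ¬ s r → b.repr i r = 0) ∧ (∀ r, s r → j (b r) = 0) := by
        intro i₁ j₁ i₂ j₂ h₁ h₂ hcase
        obtain ⟨ι, hι, hιo, b₁, s₁, hX₁, hY₁, hi₁, hj₁⟩ := ih _ hU1 (V := U) rfl (X.restrict hXU)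
          (Y.restrict hYU) i₁ j₁ (fun u => Subtype.ext (h₁ u))
        obtain ⟨κ, hκ, hκo, b₂, s₂, hX₂, hY₂, hi₂, hj₂⟩ := ih _ hU2 (V := V ⧸ U) rfl (U.mapQ U X hX)
          (U.mapQ U Y hY) i₂ j₂ (fun v => by
            obtain ⟨v, rfl⟩ := Submodule.Quotient.mk_surjective _ v
            exact h₂ v)
        let c := Module.Basis.sumQuot b₁ b₂
        have tri : ∀ (Z : Module.End L V) (hZU : ∀ u ∈ U, Z u ∈ U) (hZ : U ≤ U.comap Z),
            (∀ r t, t < r → b₁.repr (Z.restrict hZU (b₁ t)) r = 0) →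
            (∀ r t, t < r → b₂.repr (U.mapQ U Z hZ (b₂ t)) r = 0) →
            ∀ r t : ι ⊕ₗ κ, t < r → c.repr (Z (c (ofLex t))) (ofLex r) = 0 := by
          intro Z hZU hZ hZ₁ hZ₂ r t htr
          obtain ⟨r, rfl⟩ := toLex.surjective r
          obtain ⟨t, rfl⟩ := toLex.surjective t
          rw [ofLex_toLex, ofLex_toLex]
          rcases t with t | t
          · have hmem : Z (c (Sum.inl t)) ∈ U := by
              rw [Module.Basis.sumQuot_inl]
              exact hZU _ (b₁ t).2
            rcases r with r | r
            · rw [Module.Basis.sumQuot_repr_inl_of_mem b₁ b₂ _ hmem, ← hZ₁ r t (by simpa using htr)]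
              congr 2
              exact Subtype.ext (congrArg Z (Module.Basis.sumQuot_inl b₁ b₂ t))
            · exact Module.Basis.sumQuot_repr_inr_of_mem b₁ b₂ _ hmem r
          · rcases r with r | r
            · simp at htr
            · rw [Module.Basis.sumQuot_repr_inr, ← hZ₂ r t (by simpa using htr),
                ← Module.Basis.sumQuot_inr b₁ b₂ t]
              rfl
        have main : ∀ s : ι ⊕ κ → Prop, (∀ r, ¬ s r → c.repr i r = 0) → (∀ r, s r → j (c r) = 0) →
          ∃ (ι : Type) (_ : Fintype ι) (_ : LinearOrder ι) (b : Module.Basis ι L V) (s : ι → Prop),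
            (∀ r t, t < r → b.repr (X (b t)) r = 0) ∧ (∀ r t, t < r → b.repr (Y (b t)) r = 0) ∧
            (∀ r, ¬ s r → b.repr i r = 0) ∧ (∀ r, s r → j (b r) = 0) := by
          intro s hs₁ hs₂
          refine ⟨ι ⊕ₗ κ, inferInstanceAs (Fintype (ι ⊕ κ)), inferInstance, c.reindex toLex,
            fun r => s (ofLex r), fun r t htr => ?_, fun r t htr => ?_, fun r hr => ?_,
            fun r hr => ?_⟩
          · simpa using tri X hXU hX hX₁ hX₂ r t htr
          · simpa using tri Y hYU hY hY₁ hY₂ r t htr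
          · simpa using hs₁ _ hr
          · simpa using hs₂ _ hr
        rcases hcase with ⟨hj, rfl, hj'⟩ | ⟨rfl, hj⟩
        · refine main (Sum.elim (fun _ => True) s₂) ?_ ?_
          · rintro (r | r) hr
            · exact absurd trivial hr
            · rw [Module.Basis.sumQuot_repr_inr]
              exact hi₂ r hr
          · rintro (r | r) hr
            · rw [Module.Basis.sumQuot_inl]
              exact hj _
            · rw [hj', Module.Basis.sumQuot_inr]
              exact hj₂ r hr
        · refine main (Sum.elim s₁ (fun _ => False)) ?_ ?_
          · rintro (r | r) hr
            · rw [Module.Basis.sumQuot_repr_inl]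
              exact hi₁ r hr
            · exact Module.Basis.sumQuot_repr_inr_of_mem b₁ b₂ _ i₁.2 r
          · rintro (r | r) hr
            · rw [Module.Basis.sumQuot_inl, hj]
              exact hj₁ r hr
            · exact absurd hr id
      rcases hU with hU | hU
      · refine glue 0 0 (Submodule.Quotient.mk i) (U.liftQ j fun u hu => hU u hu) (fun u => ?_)
          (fun v => ?_) (Or.inl ⟨fun u => hU u u.2, rfl, fun v => rfl⟩)
        · have := h u
          rw [hU u u.2, zero_smul, add_zero] at this
          rw [this]; simp
        · change Submodule.Quotient.mk (X (Y v) - Y (X v)) + j v • Submodule.Quotient.mk i = 0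
          rw [← Submodule.Quotient.mk_smul, ← Submodule.Quotient.mk_add, h,
            Submodule.Quotient.mk_zero]
      · refine glue ⟨i, hU⟩ (j.comp U.subtype) 0 0 (fun u => h u) (fun v => ?_)
          (Or.inr ⟨rfl, fun u => rfl⟩)
        rw [smul_zero, add_zero, eq_neg_of_add_eq_zero_left (h v), Submodule.Quotient.mk_eq_zero]
        exact U.neg_mem (U.smul_mem _ hU)

end Invariant

section Triangular

theorem moment_mulVec {L : Type*} [CommRing L] {n : ℕ} (X Y : Matrix (Fin n) (Fin n) L)
    (i j v : Fin n → L) :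
    moment X Y i j *ᵥ v = X *ᵥ (Y *ᵥ v) - Y *ᵥ (X *ᵥ v) + (j ⬝ᵥ v) • i := by
  rw [moment, Matrix.add_mulVec, Matrix.sub_mulVec, Matrix.mulVec_mulVec, Matrix.mulVec_mulVec,
    Matrix.vecMulVec_mulVec]
  simp

/-- Matrix form of simultaneous triangularization. -/
theorem exists_matrix_triangular {L : Type*} [Field L] [IsAlgClosed L] {n : ℕ}
    {X Y : Matrix (Fin n) (Fin n) L} {i j : Fin n → L} (h : moment X Y i j = 0) :
    ∃ P Q : Matrix (Fin n) (Fin n) L, P * Q = 1 ∧ Q * P = 1 ∧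
      (Q * X * P).IsUpperTriangular ∧ (Q * Y * P).IsUpperTriangular ∧
      ∀ r, (Q *ᵥ i) r = 0 ∨ (j ᵥ* P) r = 0 := by
  obtain ⟨ι, hι, hιo, b, s, hX, hY, hi, hj⟩ := exists_basis_triangular n (V := Fin n → L)
    (Module.finrank_fin_fun L) (Matrix.toLin' X) (Matrix.toLin' Y) i
    (dotProductBilin L L j) (fun v => by
      have := moment_mulVec X Y i j v
      rw [h, Matrix.zero_mulVec] at this
      exact this.symm)
  have hcard : Fintype.card ι = n := by
    rw [← Module.finrank_eq_card_basis b, Module.finrank_fin_fun]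
  let e : Fin n ≃o ι := Fintype.orderIsoFinOfCardEq ι hcard
  let b' : Module.Basis (Fin n) L (Fin n → L) := b.reindex e.symm.toEquiv
  let std := Pi.basisFun L (Fin n)
  have hconj : ∀ Z : Matrix (Fin n) (Fin n) L,
      b'.toMatrix std * Z * std.toMatrix b' = LinearMap.toMatrix b' b' (Matrix.toLin' Z) := by
    intro Z
    rw [← basis_toMatrix_mul_linearMap_toMatrix_mul_basis_toMatrix (c := b') (c' := std) (b := b')
      (b' := std)]
    congr 2
    change Z = LinearMap.toMatrix (Pi.basisFun L (Fin n)) (Pi.basisFun L (Fin n))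
      (Matrix.toLin' Z)
    rw [LinearMap.toMatrix_eq_toMatrix', LinearMap.toMatrix'_toLin']
  have hrepr : ∀ v r, b'.repr v r = b.repr v (e r) := fun v r => by
    rw [Module.Basis.repr_reindex_apply]; rfl
  have htri : ∀ Z : Matrix (Fin n) (Fin n) L,
      (∀ r t, t < r → b.repr (Matrix.toLin' Z (b t)) r = 0) →
      (b'.toMatrix std * Z * std.toMatrix b').IsUpperTriangular := by
    intro Z hZ r t htr
    rw [hconj, LinearMap.toMatrix_apply]
    rw [hrepr, Module.Basis.reindex_apply]
    exact hZ (e r) (e t) (e.lt_iff_lt.2 htr)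
  refine ⟨std.toMatrix b', b'.toMatrix std, Module.Basis.toMatrix_mul_toMatrix_flip _ _,
    Module.Basis.toMatrix_mul_toMatrix_flip _ _, htri X hX, htri Y hY, fun r => ?_⟩
  by_cases hs : s (e r)
  · right
    have := hj _ hs
    rw [← this]
    simp [Matrix.vecMul, std, b', dotProduct, Module.Basis.toMatrix_apply]
  · left
    have := hi _ hs
    rw [← this]
    have h2 : b'.toMatrix std *ᵥ i = b'.repr i :=
      Module.Basis.toMatrix_mulVec_repr std b' i
    rw [h2, hrepr]

end Triangular

/-! ### The symplectic form and the moment map -/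

section Symplectic

variable {L : Type*} {n : ℕ}

/-- Quadruples `(X, Y, i, j)` over `L`; they also serve as tangent vectors at such quadruples. -/
abbrev Quad (n : ℕ) (L : Type*) : Type _ :=
  Matrix (Fin n) (Fin n) L × Matrix (Fin n) (Fin n) L × (Fin n → L) × (Fin n → L)

/-- The symplectic form `tr (dX ∧ dY) - dj ∧ di` on quadruples. -/
def symplecticForm (n : ℕ) (L : Type*) [CommRing L] : LinearMap.BilinForm L (Quad n L) :=
  LinearMap.mk₂ L (fun v w => (v.1 * w.2.1).trace - (w.1 * v.2.1).trace
      - (v.2.2.2 ⬝ᵥ w.2.2.1 - w.2.2.2 ⬝ᵥ v.2.2.1))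
    (by intros; simp [add_mul, mul_add]; ring) (by intros; simp; ring)
    (by intros; simp [add_mul, mul_add]; ring) (by intros; simp; ring)

theorem symplecticForm_apply [CommRing L] (v w : Quad n L) :
    symplecticForm n L v w = (v.1 * w.2.1).trace - (w.1 * v.2.1).trace
      - (v.2.2.2 ⬝ᵥ w.2.2.1 - w.2.2.2 ⬝ᵥ v.2.2.1) := rfl

theorem symplecticForm_swap [CommRing L] (v w : Quad n L) :
    symplecticForm n L v w = - symplecticForm n L w v := by
  rw [symplecticForm_apply, symplecticForm_apply]; ring

theorem symplecticForm_ker [Field L] : LinearMap.ker (symplecticForm n L) = ⊥ := by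
  rw [LinearMap.ker_eq_bot']
  rintro ⟨A, B, I, H⟩ h
  have h' : ∀ w, symplecticForm n L (A, B, I, H) w = 0 := fun w => by rw [h]; rfl
  simp only [symplecticForm_apply] at h'
  have hA : A = 0 := by
    rw [Matrix.ext_iff_trace_mul_right]
    intro x
    simpa using h' (0, x, 0, 0)
  have hB : B = 0 := by
    rw [Matrix.ext_iff_trace_mul_left]
    intro x
    simpa using h' (x, 0, 0, 0)
  have hH : H = 0 := dotProduct_eq_zero H fun w => by simpa using h' (0, 0, w, 0)
  have hI : I = 0 := dotProduct_eq_zero I fun w => by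
    rw [dotProduct_comm]; simpa using h' (0, 0, 0, w)
  rw [hA, hB, hH, hI]; rfl

theorem finrank_quad [Field L] : Module.finrank L (Quad n L) = 2 * (n ^ 2 + n) := by
  simp [Quad, Module.finrank_prod, Module.finrank_matrix]; ring

/-- An isotropic subspace has at most half the dimension. -/
theorem finrank_le_of_isotropic [Field L] (W : Submodule L (Quad n L))
    (hW : ∀ v ∈ W, ∀ w ∈ W, symplecticForm n L v w = 0) : Module.finrank L W ≤ n ^ 2 + n := by
  have h1 := LinearMap.BilinForm.finrank_add_finrank_orthogonal' (B := symplecticForm n L) W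
  have h2 : W ≤ (symplecticForm n L).orthogonal W := fun w hw v hv => hW v hv w hw
  have h3 := Submodule.finrank_mono h2
  rw [symplecticForm_ker, inf_bot_eq, finrank_bot, finrank_quad] at h1
  omega

/-- The differential at `q` of the map `[X, Y] + i j`, applied to the tangent vector `v`. -/
def dmoment [CommRing L] (q v : Quad n L) : Matrix (Fin n) (Fin n) L :=
  v.1 * q.2.1 - q.2.1 * v.1 + (q.1 * v.2.1 - v.2.1 * q.1) + vecMulVec v.2.2.1 q.2.2.2
    + vecMulVec q.2.2.1 v.2.2.2

/-- The infinitesimal action of `ξ ∈ gl_n` at the quadruple `q`. -/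
def gauge [CommRing L] (q : Quad n L) (ξ : Matrix (Fin n) (Fin n) L) : Quad n L :=
  (ξ * q.1 - q.1 * ξ, ξ * q.2.1 - q.2.1 * ξ, ξ *ᵥ q.2.2.1, -(q.2.2.2 ᵥ* ξ))

/-- The map `[X, Y] + i j` is a moment map for the action of `GL_n`. -/
theorem symplecticForm_gauge [CommRing L] (q v : Quad n L) (ξ : Matrix (Fin n) (Fin n) L) :
    symplecticForm n L v (gauge q ξ) = -(ξ * dmoment q v).trace := by
  obtain ⟨X, Y, i, j⟩ := q
  obtain ⟨A, B, I, H⟩ := v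
  simp only [symplecticForm_apply, gauge, dmoment]
  have h1 : (A * (ξ * Y - Y * ξ)).trace = (ξ * (Y * A)).trace - (ξ * (A * Y)).trace := by
    rw [mul_sub, trace_sub, trace_mul_comm A (ξ * Y), mul_assoc ξ, ← mul_assoc A,
      trace_mul_comm (A * Y)]
  have h2 : ((ξ * X - X * ξ) * B).trace = (ξ * (X * B)).trace - (ξ * (B * X)).trace := by
    rw [sub_mul, trace_sub, mul_assoc, mul_assoc X, trace_mul_comm X, mul_assoc]
  have h3 : H ⬝ᵥ (ξ *ᵥ i) = (ξ * vecMulVec i H).trace := by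
    rw [mul_vecMulVec, trace_vecMulVec, dotProduct_comm]
  have h4 : (j ᵥ* ξ) ⬝ᵥ I = (ξ * vecMulVec I j).trace := by
    rw [mul_vecMulVec, trace_vecMulVec, dotProduct_comm (ξ *ᵥ I), dotProduct_mulVec]
  rw [h1, h2, h3, neg_dotProduct, h4]
  simp only [mul_add, mul_sub, trace_add, trace_sub]
  ring

theorem dmoment_gauge [CommRing L] (q : Quad n L) (ξ : Matrix (Fin n) (Fin n) L)
    (hq : moment q.1 q.2.1 q.2.2.1 q.2.2.2 = 0) : dmoment q (gauge q ξ) = 0 := by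
  obtain ⟨X, Y, i, j⟩ := q
  have : dmoment (X, Y, i, j) (gauge (X, Y, i, j) ξ) = ξ * moment X Y i j - moment X Y i j * ξ := by
    simp only [dmoment, gauge, moment, vecMulVec_neg, ← mul_vecMulVec, ← vecMulVec_mul]
    noncomm_ring
  rw [this, hq]; simp

theorem dmoment_add [CommRing L] (q v w : Quad n L) :
    dmoment q (v + w) = dmoment q v + dmoment q w := by
  simp only [dmoment, Prod.fst_add, Prod.snd_add, add_vecMulVec, vecMulVec_add]
  noncomm_ring

/-- On the zero fibre of the moment map, the directions of the group action are orthogonal to all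
tangent vectors of the fibre. -/
theorem symplecticForm_gauge_add [CommRing L] (q p₁ p₂ : Quad n L)
    (ξ₁ ξ₂ : Matrix (Fin n) (Fin n) L) (hq : moment q.1 q.2.1 q.2.2.1 q.2.2.2 = 0)
    (h₁ : dmoment q p₁ = 0) (h₂ : dmoment q p₂ = 0) :
    symplecticForm n L (gauge q ξ₁ + p₁) (gauge q ξ₂ + p₂) = symplecticForm n L p₁ p₂ := by
  have e1 : symplecticForm n L (gauge q ξ₁ + p₁) (gauge q ξ₂) = 0 := by
    rw [symplecticForm_gauge, dmoment_add, dmoment_gauge q ξ₁ hq, h₁]; simp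
  have e2 : symplecticForm n L (gauge q ξ₁) p₂ = 0 := by
    rw [symplecticForm_swap, symplecticForm_gauge, h₂]; simp
  rw [map_add, e1, zero_add, map_add, LinearMap.add_apply, e2, zero_add]

end Symplectic

/-! ### Derivations of matrices -/

section MatrixDerivation

variable {k L : Type*} [CommRing k] [CommRing L] [Algebra k L] (D : Derivation k L L)

theorem derivation_mul {l m n : Type*} [Fintype m] (A : Matrix l m L) (B : Matrix m n L) :
    (A * B).map D = A.map D * B + A * B.map D := by
  ext a b
  simp only [Matrix.map_apply, Matrix.mul_apply, Matrix.add_apply, map_sum, D.leibniz, smul_eq_mul,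
    Finset.sum_add_distrib]
  rw [add_comm]
  simp only [mul_comm]

theorem derivation_mulVec {l m : Type*} [Fintype m] (A : Matrix l m L) (v : m → L) :
    D ∘ (A *ᵥ v) = A.map D *ᵥ v + A *ᵥ (D ∘ v) := by
  ext a
  simp only [Function.comp_apply, Matrix.mulVec, dotProduct, map_sum, D.leibniz, smul_eq_mul,
    Finset.sum_add_distrib, Pi.add_apply, Matrix.map_apply]
  rw [add_comm]
  simp only [mul_comm]

theorem derivation_vecMul {l m : Type*} [Fintype l] (v : l → L) (A : Matrix l m L) :
    D ∘ (v ᵥ* A) = (D ∘ v) ᵥ* A + v ᵥ* A.map D := by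
  ext a
  simp only [Function.comp_apply, Matrix.vecMul, dotProduct, map_sum, D.leibniz, smul_eq_mul,
    Finset.sum_add_distrib, Pi.add_apply, Matrix.map_apply]
  rw [add_comm]
  simp only [mul_comm]

/-- The tangent vector at `q` obtained by applying a derivation to all entries. -/
def tangent {n : ℕ} (q : Quad n L) : Quad n L :=
  (q.1.map D, q.2.1.map D, D ∘ q.2.2.1, D ∘ q.2.2.2)

theorem moment_map_derivation {n : ℕ} (X Y : Matrix (Fin n) (Fin n) L) (i j : Fin n → L) :
    (moment X Y i j).map D = dmoment (X, Y, i, j) (tangent D (X, Y, i, j)) := by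
  have hv : (vecMulVec i j).map D = vecMulVec (D ∘ i) j + vecMulVec i (D ∘ j) := by
    ext a b
    simp [vecMulVec_apply]
    ring
  have : (moment X Y i j).map D = (X * Y).map D - (Y * X).map D + (vecMulVec i j).map D := by
    ext a b; simp [moment]
  rw [this, derivation_mul, derivation_mul, hv]
  simp only [dmoment, tangent]
  abel

theorem dmoment_tangent {n : ℕ} {q : Quad n L} (hq : moment q.1 q.2.1 q.2.2.1 q.2.2.2 = 0) :
    dmoment q (tangent D q) = 0 := by
  obtain ⟨X, Y, i, j⟩ := q
  rw [← moment_map_derivation D X Y i j, hq]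
  ext; simp

end MatrixDerivation

/-! ### Isotropy of the tangent vectors -/

section Conjugation

variable {n : ℕ}

/-- The quadruple `q` in another basis: `P` is the matrix of the new basis and `Q` its inverse. -/
def conj {L : Type*} [CommRing L] (P Q : Matrix (Fin n) (Fin n) L) (q : Quad n L) : Quad n L :=
  (Q * q.1 * P, Q * q.2.1 * P, Q *ᵥ q.2.2.1, q.2.2.2 ᵥ* P)

theorem moment_conj {L : Type*} [CommRing L] {P Q : Matrix (Fin n) (Fin n) L} (h : P * Q = 1)
    (X Y : Matrix (Fin n) (Fin n) L) (i j : Fin n → L) :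
    moment (Q * X * P) (Q * Y * P) (Q *ᵥ i) (j ᵥ* P) = Q * moment X Y i j * P := by
  have e : ∀ A B : Matrix (Fin n) (Fin n) L, Q * A * P * (Q * B * P) = Q * (A * B) * P := by
    intro A B
    calc Q * A * P * (Q * B * P) = Q * A * (P * Q) * B * P := by noncomm_ring
      _ = Q * (A * B) * P := by rw [h]; noncomm_ring
  rw [moment, moment, e, e, mul_add, mul_sub, add_mul, sub_mul, mul_vecMulVec, vecMulVec_mul]

theorem symplecticForm_conj {L : Type*} [CommRing L] {P Q : Matrix (Fin n) (Fin n) L}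
    (h : P * Q = 1) (v w : Quad n L) :
    symplecticForm n L (conj P Q v) (conj P Q w) = symplecticForm n L v w := by
  have e : ∀ A B : Matrix (Fin n) (Fin n) L, (Q * A * P * (Q * B * P)).trace = (A * B).trace := by
    intro A B
    calc (Q * A * P * (Q * B * P)).trace = (Q * (A * (P * Q) * B * P)).trace := by noncomm_ring
      _ = (A * B).trace := by rw [h, mul_one, trace_mul_comm, mul_assoc, h, mul_one]
  have e2 : ∀ a b : Fin n → L, (a ᵥ* P) ⬝ᵥ (Q *ᵥ b) = a ⬝ᵥ b := by
    intro a b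
    rw [dotProduct_mulVec, vecMul_vecMul, h, vecMul_one]
  simp only [symplecticForm_apply, conj, e, e2]

/-- A change of basis alters the tangent vector of a derivation by an infinitesimal gauge
transformation. -/
theorem conj_tangent {k L : Type*} [CommRing k] [CommRing L] [Algebra k L] (D : Derivation k L L)
    {P Q : Matrix (Fin n) (Fin n) L} (h : P * Q = 1) (h' : Q * P = 1) (q : Quad n L) :
    conj P Q (tangent D q) = gauge (conj P Q q) (Q * P.map D) + tangent D (conj P Q q) := by
  have hQ : Q.map D = -(Q * P.map D * Q) := by
    have h1 := derivation_mul D Q P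
    have h0 : (1 : Matrix (Fin n) (Fin n) L).map D = 0 := by
      ext a b
      by_cases hab : a = b <;> simp [hab]
    rw [h', h0] at h1
    calc Q.map D = (Q.map D * P + Q * P.map D) * Q - Q * P.map D * Q := by
          rw [add_mul, mul_assoc, h, mul_one, add_sub_cancel_right]
      _ = _ := by rw [← h1]; simp
  have e1 : ∀ A : Matrix (Fin n) (Fin n) L, Q * A.map D * P =
      Q * P.map D * (Q * A * P) - Q * A * P * (Q * P.map D) + (Q * A * P).map D := by
    intro A
    have h2 : Q * A * P * (Q * P.map D) = Q * A * P.map D := by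
      rw [mul_assoc (Q * A), ← mul_assoc P, h, one_mul]
    rw [derivation_mul, derivation_mul, hQ, h2]
    noncomm_ring
  refine Prod.ext (e1 _) (Prod.ext (e1 _) (Prod.ext ?_ ?_))
  · change Q *ᵥ (D ∘ q.2.2.1) = (Q * P.map D) *ᵥ (Q *ᵥ q.2.2.1) + D ∘ (Q *ᵥ q.2.2.1)
    rw [derivation_mulVec, hQ, mulVec_mulVec, neg_mulVec]
    abel
  · change (D ∘ q.2.2.2) ᵥ* P = -((q.2.2.2 ᵥ* P) ᵥ* (Q * P.map D)) + D ∘ (q.2.2.2 ᵥ* P)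
    rw [derivation_vecMul, vecMul_vecMul, ← mul_assoc, h, one_mul]
    abel

theorem diag_mul_of_isUpperTriangular {L : Type*} [CommRing L] {A B : Matrix (Fin n) (Fin n) L}
    (hA : A.IsUpperTriangular) (hB : B.IsUpperTriangular) (r : Fin n) :
    (A * B) r r = A r r * B r r := by
  rw [Matrix.mul_apply, Finset.sum_eq_single r]
  · intro s _ hs
    rcases lt_or_gt_of_ne hs with h | h
    · rw [hA h, zero_mul]
    · rw [hB h, mul_zero]
  · simp

/-- For triangular `X` and `Y` the form evaluates to `∑ (D₁ x_r D₂ y_r - D₂ x_r D₁ y_r)` in the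
diagonal entries, so it vanishes if the `y_r` are constants. -/
theorem symplecticForm_tangent_triangular {k L : Type*} [CommRing k] [Field L] [Algebra k L]
    (D₁ D₂ : Derivation k L L) (q : Quad n L) (hX : q.1.IsUpperTriangular)
    (hY : q.2.1.IsUpperTriangular) (hij : ∀ r, q.2.2.1 r = 0 ∨ q.2.2.2 r = 0)
    (h₁ : ∀ r, D₁ (q.2.1 r r) = 0) (h₂ : ∀ r, D₂ (q.2.1 r r) = 0) :
    symplecticForm n L (tangent D₁ q) (tangent D₂ q) = 0 := by
  have hmap : ∀ (D : Derivation k L L) {A : Matrix (Fin n) (Fin n) L}, A.IsUpperTriangular →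
      (A.map D).IsUpperTriangular := by
    intro D A hA r s hrs
    rw [Matrix.map_apply, hA hrs, map_zero]
  rw [symplecticForm_apply]
  have e : ∀ D D' : Derivation k L L, (∀ r, D' (q.2.1 r r) = 0) →
      (q.1.map D * q.2.1.map D').trace = 0 := by
    intro D D' h
    refine Finset.sum_eq_zero fun r _ => ?_
    rw [Matrix.diag_apply, diag_mul_of_isUpperTriangular (hmap D hX) (hmap D' hY), Matrix.map_apply,
      Matrix.map_apply, h, mul_zero]
  have e' : ∀ D D' : Derivation k L L, (D ∘ q.2.2.2) ⬝ᵥ (D' ∘ q.2.2.1) = 0 := by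
    intro D D'
    refine Finset.sum_eq_zero fun r _ => ?_
    rcases hij r with h | h <;> simp [h]
  simp only [tangent, e _ _ h₁, e _ _ h₂, e', sub_zero]

/-- The symplectic form vanishes on the tangent vectors of derivations that kill the eigenvalues of
`Y`. -/
theorem symplecticForm_tangent_eq_zero {k L : Type*} [CommRing k] [Field L] [IsAlgClosed L]
    [Algebra k L] (D₁ D₂ : Derivation k L L) (q : Quad n L)
    (hq : moment q.1 q.2.1 q.2.2.1 q.2.2.2 = 0)
    (h₁ : ∀ y ∈ q.2.1.charpoly.roots, D₁ y = 0) (h₂ : ∀ y ∈ q.2.1.charpoly.roots, D₂ y = 0) :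
    symplecticForm n L (tangent D₁ q) (tangent D₂ q) = 0 := by
  obtain ⟨P, Q, hPQ, hQP, hX, hY, hij⟩ := exists_matrix_triangular hq
  have hroot : ∀ r, (Q * q.2.1 * P) r r ∈ q.2.1.charpoly.roots := by
    intro r
    have hc : q.2.1.charpoly = (Q * q.2.1 * P).charpoly := by
      rw [Matrix.charpoly_mul_comm, ← mul_assoc, hPQ, one_mul]
    rw [Polynomial.mem_roots (Matrix.charpoly_monic _).ne_zero, hc,
      Matrix.charpoly_of_isUpperTriangular _ hY, Polynomial.IsRoot, Polynomial.eval_prod]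
    exact Finset.prod_eq_zero (Finset.mem_univ r) (by simp)
  have hq' : moment (conj P Q q).1 (conj P Q q).2.1 (conj P Q q).2.2.1 (conj P Q q).2.2.2 = 0 := by
    simp only [conj]
    rw [moment_conj hPQ, hq]
    simp
  rw [← symplecticForm_conj hPQ, conj_tangent D₁ hPQ hQP, conj_tangent D₂ hPQ hQP,
    symplecticForm_gauge_add _ _ _ _ _ hq' (dmoment_tangent D₁ hq') (dmoment_tangent D₂ hq')]
  exact symplecticForm_tangent_triangular D₁ D₂ _ hX hY hij (fun r => h₁ _ (hroot r))
    (fun r => h₂ _ (hroot r))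

/-- The tangent vector as a linear function of the derivation. -/
def tangentMap (k : Type*) {L : Type*} [CommRing k] [Field L] [Algebra k L] (q : Quad n L) :
    Derivation k L L →ₗ[L] Quad n L where
  toFun D := tangent D q
  map_add' _ _ := rfl
  map_smul' _ _ := rfl

open scoped Classical in
theorem finrank_derivation_le {k L : Type*} [CommRing k] [Field L] [IsAlgClosed L]
    [Algebra k L] [Module.Finite L (Derivation k L L)] (q : Quad n L)
    (hq : moment q.1 q.2.1 q.2.2.1 q.2.2.2 = 0)
    (hinj : ∀ D : Derivation k L L, tangent D q = 0 → D = 0) :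
    Module.finrank L (Derivation k L L) ≤ n ^ 2 + n + q.2.1.charpoly.roots.toFinset.card := by
  let S := q.2.1.charpoly.roots.toFinset
  let ev : Derivation k L L →ₗ[L] (S → L) :=
    { toFun := fun D y => D y
      map_add' := fun _ _ => rfl
      map_smul' := fun _ _ => rfl }
  have h1 := ev.finrank_range_add_finrank_ker
  have h2 : Module.finrank L (LinearMap.range ev) ≤ S.card := by
    refine (Submodule.finrank_le _).trans ?_
    rw [Module.finrank_fintype_fun_eq_card, Fintype.card_coe]
  have hinj' : Function.Injective (tangentMap k q) := by
    rw [injective_iff_map_eq_zero]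
    exact hinj
  have h3 : Module.finrank L ((LinearMap.ker ev).map (tangentMap k q)) ≤ n ^ 2 + n := by
    have hker : ∀ D ∈ LinearMap.ker ev, ∀ y ∈ q.2.1.charpoly.roots, D y = 0 := fun D hD y hy =>
      congrFun (LinearMap.mem_ker.1 hD) ⟨y, Multiset.mem_toFinset.2 hy⟩
    refine finrank_le_of_isotropic _ ?_
    rintro _ ⟨D₁, hD₁, rfl⟩ _ ⟨D₂, hD₂, rfl⟩
    exact symplecticForm_tangent_eq_zero D₁ D₂ q hq (hker D₁ hD₁) (hker D₂ hD₂)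
  rw [((LinearMap.ker ev).equivMapOfInjective _ hinj').finrank_eq.symm] at h3
  change _ ≤ n ^ 2 + n + S.card
  omega

end Conjugation

/-! ### The dimension of irreducible closed subsets -/

section Dimension

variable {n : ℕ}

/-- The quadruple over `L` that corresponds to a homomorphism from the coordinate ring to `L`. -/
def quadMap {L : Type*} [CommRing L] (φ : CoordRing n →+* L) : Quad n L :=
  ((genX n).map φ, (genY n).map φ, φ ∘ genI n, φ ∘ genJ n)

theorem moment_map {R S : Type*} [CommRing R] [CommRing S] (φ : R →+* S)
    (X Y : Matrix (Fin n) (Fin n) R) (i j : Fin n → R) :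
    moment (X.map φ) (Y.map φ) (φ ∘ i) (φ ∘ j) = (moment X Y i j).map φ := by
  ext r s
  simp [moment, Matrix.mul_apply, vecMulVec_apply]

theorem moment_quadMap {L : Type*} [CommRing L] (φ : CoordRing n →+* L) (hφ : ∀ f ∈ J n, φ f = 0) :
    moment (quadMap φ).1 (quadMap φ).2.1 (quadMap φ).2.2.1 (quadMap φ).2.2.2 = 0 := by
  refine (moment_map φ (genX n) (genY n) (genI n) (genJ n)).trans ?_
  ext r s
  exact hφ _ (Ideal.subset_span ⟨(r, s), rfl⟩)

open scoped Classical in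
/-- The dimension of an irreducible closed subset of `M` is at most `n² + n` plus the number of
distinct eigenvalues of `Y` at its generic point. -/
theorem ringKrullDim_le_add_card_roots (P : Ideal (CoordRing n)) [P.IsPrime] (hP : J n ≤ P)
    (L : Type*) [Field L] [IsAlgClosed L] [CharZero L] [Algebra ℂ L] [Algebra (CoordRing n ⧸ P) L]
    [IsScalarTower ℂ (CoordRing n ⧸ P) L] [FaithfulSMul (CoordRing n ⧸ P) L]
    [Algebra.IsAlgebraic (CoordRing n ⧸ P) L] :
    ringKrullDim (CoordRing n ⧸ P) ≤ ((n ^ 2 + n + ((genY n).map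
      ((algebraMap (CoordRing n ⧸ P) L).comp
        (Ideal.Quotient.mk P))).charpoly.roots.toFinset.card : ℕ) : WithBot ℕ∞) := by
  obtain ⟨hfin, hle⟩ := ringKrullDim_le_finrank_derivation ℂ (CoordRing n ⧸ P) L
  refine hle.trans ?_
  let φ : CoordRing n →+* L := (algebraMap (CoordRing n ⧸ P) L).comp (Ideal.Quotient.mk P)
  have hφ : ∀ f ∈ J n, φ f = 0 := by
    intro f hf
    simp only [φ, RingHom.comp_apply, Ideal.Quotient.eq_zero_iff_mem.2 (hP hf), map_zero]
  have h := finrank_derivation_le (k := ℂ) (quadMap φ) (moment_quadMap φ hφ) ?_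
  · exact_mod_cast h
  intro D hD
  refine derivation_eq_zero_of_isAlgebraic (B := CoordRing n ⧸ P) D fun b => ?_
  obtain ⟨f, rfl⟩ := Ideal.Quotient.mk_surjective b
  change D (φ f) = 0
  have hX : ∀ v, D (φ (MvPolynomial.X v)) = 0 := by
    rintro (⟨r, s⟩ | ⟨r, s⟩ | r | r)
    · exact congrFun (congrFun (congrArg Prod.fst hD) r) s
    · exact congrFun (congrFun (congrArg (fun q => q.2.1) hD) r) s
    · exact congrFun (congrArg (fun q => q.2.2.1) hD) r
    · exact congrFun (congrArg (fun q => q.2.2.2) hD) r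
  induction f using MvPolynomial.induction_on with
  | C a =>
    have : φ (MvPolynomial.C a) = algebraMap ℂ L a := by
      rw [IsScalarTower.algebraMap_apply ℂ (CoordRing n ⧸ P) L]; rfl
    rw [this, Derivation.map_algebraMap]
  | add p q hp hq => rw [map_add, map_add, hp, hq, add_zero]
  | mul_X p v hp => rw [map_mul, D.leibniz, hp, hX, smul_zero, smul_zero, add_zero]

/-- The resultant of the characteristic polynomial and its derivative, up to sign its discriminant.
The degrees are prescribed, so that it commutes with ring homomorphisms. -/
def rootDisc {R : Type*} [CommRing R] (A : Matrix (Fin n) (Fin n) R) : R :=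
  Polynomial.resultant A.charpoly (Polynomial.derivative A.charpoly) n (n - 1)

theorem map_rootDisc {R S : Type*} [CommRing R] [CommRing S] (φ : R →+* S)
    (A : Matrix (Fin n) (Fin n) R) : rootDisc (A.map φ) = φ (rootDisc A) := by
  rw [rootDisc, rootDisc, Matrix.charpoly_map, Polynomial.derivative_map,
    Polynomial.resultant_map_map]

theorem rootDisc_ne_zero_iff {L : Type*} [Field L] [CharZero L] [IsAlgClosed L]
    (A : Matrix (Fin n) (Fin n) L) : rootDisc A ≠ 0 ↔ A.charpoly.roots.Nodup := by
  have hn : A.charpoly.natDegree = n := by rw [Matrix.charpoly_natDegree_eq_dim, Fintype.card_fin]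
  have h0 : A.charpoly ≠ 0 := A.charpoly_monic.ne_zero
  have h1 : (Polynomial.derivative A.charpoly).natDegree = n - 1 := by
    rw [Polynomial.natDegree_derivative, hn]
  have h2 : rootDisc A = Polynomial.resultant A.charpoly (Polynomial.derivative A.charpoly) := by
    rw [rootDisc, hn, h1]
  rw [h2, Ne, Polynomial.resultant_eq_zero_iff, Polynomial.nodup_roots_iff_of_splits h0
    (IsAlgClosed.splits _), Polynomial.separable_def]
  simp [h0]

end Dimension

/-! ### Complete intersection -/

section CompleteIntersection

variable {n : ℕ}

theorem ringKrullDim_quotient_le_of_forall_isPrime {A : Type*} [CommRing A] (I : Ideal A)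
    {d : WithBot ℕ∞} (h : ∀ P : Ideal A, P.IsPrime → I ≤ P → ringKrullDim (A ⧸ P) ≤ d) :
    ringKrullDim (A ⧸ I) ≤ d := by
  rw [ringKrullDim_quotient]
  refine iSup_le fun l => ?_
  let P := l.head.1
  refine le_trans ?_ (h P.asIdeal P.isPrime l.head.2)
  rw [ringKrullDim_quotient]
  let l' : LTSeries (PrimeSpectrum.zeroLocus (P.asIdeal : Set A)) :=
    ⟨l.length, fun i => ⟨(l i).1, l.head_le i⟩, fun i => l.step i⟩
  exact le_iSup (fun p : LTSeries _ => (p.length : WithBot ℕ∞)) l'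

theorem ringKrullDim_quotient_le_of_isPrime (P : Ideal (CoordRing n)) [P.IsPrime] (hP : J n ≤ P) :
    ringKrullDim (CoordRing n ⧸ P) ≤ ((n ^ 2 + 2 * n : ℕ) : WithBot ℕ∞) ∧
      (rootDisc (genY n) ∈ P →
        ringKrullDim (CoordRing n ⧸ P) < ((n ^ 2 + 2 * n : ℕ) : WithBot ℕ∞)) := by
  classical
  let L := AlgebraicClosure (FractionRing (CoordRing n ⧸ P))
  have : IsScalarTower ℂ (CoordRing n ⧸ P) L :=
      IsScalarTower.of_algebraMap_eq (S := CoordRing n ⧸ P) fun x => by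
    rw [IsScalarTower.algebraMap_apply ℂ (FractionRing (CoordRing n ⧸ P)) L,
      IsScalarTower.algebraMap_apply ℂ (CoordRing n ⧸ P) (FractionRing (CoordRing n ⧸ P)),
      ← IsScalarTower.algebraMap_apply (CoordRing n ⧸ P) (FractionRing (CoordRing n ⧸ P)) L]
  have : CharZero L :=
    ((algebraMap ℂ L).charZero_iff (algebraMap ℂ L).injective).1 inferInstance
  have : FaithfulSMul (CoordRing n ⧸ P) L := by
    refine (faithfulSMul_iff_algebraMap_injective (CoordRing n ⧸ P) L).2 ?_
    rw [IsScalarTower.algebraMap_eq (CoordRing n ⧸ P) (FractionRing (CoordRing n ⧸ P)) L]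
    exact (algebraMap (FractionRing (CoordRing n ⧸ P)) L).injective.comp
      (IsFractionRing.injective (CoordRing n ⧸ P) (FractionRing (CoordRing n ⧸ P)))
  have : Algebra.IsAlgebraic (CoordRing n ⧸ P) L :=
    (IsFractionRing.comap_isAlgebraic_iff (K := FractionRing (CoordRing n ⧸ P))).2 inferInstance
  have h := ringKrullDim_le_add_card_roots P hP L
  set φ := (algebraMap (CoordRing n ⧸ P) L).comp (Ideal.Quotient.mk P) with hφ
  set Y := (genY n).map φ with hY
  have hcard : Multiset.card Y.charpoly.roots ≤ n := by
    refine (Polynomial.card_roots' _).trans ?_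
    rw [Matrix.charpoly_natDegree_eq_dim, Fintype.card_fin]
  have hle := Multiset.toFinset_card_le Y.charpoly.roots
  refine ⟨h.trans ?_, fun hd => h.trans_lt ?_⟩
  · have : n ^ 2 + n + Y.charpoly.roots.toFinset.card ≤ n ^ 2 + 2 * n := by omega
    exact_mod_cast this
  · have h0 : rootDisc Y = 0 := by
      rw [hY, map_rootDisc, hφ, RingHom.comp_apply, Ideal.Quotient.eq_zero_iff_mem.2 hd, map_zero]
    have h1 : ¬ Y.charpoly.roots.Nodup := fun h => (rootDisc_ne_zero_iff Y).2 h h0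
    rw [← Multiset.toFinset_card_eq_card_iff_nodup] at h1
    have : n ^ 2 + n + Y.charpoly.roots.toFinset.card < n ^ 2 + 2 * n := by omega
    exact_mod_cast this

theorem ringKrullDim_quotient_J_le :
    ringKrullDim (CoordRing n ⧸ J n) ≤ ((n ^ 2 + 2 * n : ℕ) : WithBot ℕ∞) :=
  ringKrullDim_quotient_le_of_forall_isPrime _ fun P _ hP =>
    (ringKrullDim_quotient_le_of_isPrime P hP).1

/-- The entries of the generic matrix `[X, Y] + i j`, as a list. -/
def momentEntries (n : ℕ) : List (CoordRing n) :=
  (Finset.univ : Finset (Fin n × Fin n)).toList.map fun p =>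
    moment (genX n) (genY n) (genI n) (genJ n) p.1 p.2

theorem ofList_momentEntries : Ideal.ofList (momentEntries n) = J n := by
  rw [Ideal.ofList, J]
  congr 1
  ext f
  simp [momentEntries]

theorem card_coord : Nat.card (Coord n) = n ^ 2 + 2 * n + (momentEntries n).length := by
  simp [momentEntries, Nat.card_eq_fintype_card]
  ring

theorem isHomogeneous_momentEntries : ∀ f ∈ momentEntries n, ∃ d ≠ 0, f.IsHomogeneous d := by
  intro f hf
  obtain ⟨p, -, rfl⟩ := List.mem_map.1 hf
  refine ⟨2, two_ne_zero, ?_⟩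
  have hmul : ∀ a b : Coord n,
      (MvPolynomial.X a * MvPolynomial.X b : CoordRing n).IsHomogeneous 2 := fun a b =>
    (isHomogeneous_X ℂ a).mul (isHomogeneous_X ℂ b)
  simp only [moment, Matrix.add_apply, Matrix.sub_apply, Matrix.mul_apply, vecMulVec_apply]
  refine IsHomogeneous.add (IsHomogeneous.sub ?_ ?_) (hmul _ _) <;>
    exact IsHomogeneous.sum _ _ _ fun _ _ => hmul _ _

theorem isCompleteIntersection_J : IsCompleteIntersection (J n) :=
  ⟨momentEntries n, isRegular_of_isHomogeneous_of_ringKrullDim_le card_coord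
    (by rw [ofList_momentEntries]; exact ringKrullDim_quotient_J_le) isHomogeneous_momentEntries,
    ofList_momentEntries⟩

/-- All associated primes of `J` have the expected dimension. Hence they are minimal, and the
discriminant of `Y` does not vanish identically on their zero loci. -/
theorem ringKrullDim_quotient_of_mem_associatedPrimes {P : Ideal (CoordRing n)}
    (hP : P ∈ associatedPrimes (CoordRing n) (CoordRing n ⧸ J n)) :
    ringKrullDim (CoordRing n ⧸ P) = ((n ^ 2 + 2 * n : ℕ) : WithBot ℕ∞) ∧
      rootDisc (genY n) ∉ P ∧ P ∈ (J n).minimalPrimes := by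
  have hprime : P.IsPrime := hP.isPrime
  have hJP : J n ≤ P := by
    have := hP.annihilator_le
    rwa [Submodule.annihilator_top, Ideal.annihilator_quotient] at this
  obtain ⟨h1, h2⟩ := ringKrullDim_quotient_le_of_isPrime P hJP
  have h3 : ((n ^ 2 + 2 * n : ℕ) : WithBot ℕ∞) ≤ ringKrullDim (CoordRing n ⧸ P) :=
    le_ringKrullDim_of_mem_associatedPrimes (card_coord (n := n))
      (by rw [ofList_momentEntries]; exact ringKrullDim_quotient_J_le)
      (by rwa [ofList_momentEntries])
  refine ⟨le_antisymm h1 h3, fun h => (h2 h).not_ge h3, ⟨⟨hprime, hJP⟩, ?_⟩⟩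
  rintro p ⟨hp, hJp⟩ hpP
  by_contra hne
  have h4 := ringKrullDim_quotient_add_one_le_of_lt (lt_of_le_not_ge hpP hne)
  have h5 := (h4.trans (ringKrullDim_quotient_le_of_isPrime p hJp).1)
  have h6 := (add_le_add_left h3 1).trans h5
  have h7 : n ^ 2 + 2 * n + 1 ≤ n ^ 2 + 2 * n := by exact_mod_cast h6
  omega

theorem mem_associatedPrimes_of_mem_minimalPrimes {P : Ideal (CoordRing n)}
    (hP : P ∈ (J n).minimalPrimes) : P ∈ associatedPrimes (CoordRing n) (CoordRing n ⧸ J n) := by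
  refine Module.associatedPrimes.minimalPrimes_annihilator_subset_associatedPrimes _ _ ?_
  rwa [Ideal.annihilator_quotient]

end CompleteIntersection

/-! ### Normal forms of points -/

section Points

variable {n : ℕ}

theorem exists_eigenbasis {K : Type*} [Field K] [IsAlgClosed K] (Y : Matrix (Fin n) (Fin n) K)
    (hY : Y.charpoly.roots.Nodup) :
    ∃ (g h : Matrix (Fin n) (Fin n) K) (y : Fin n → K), g * h = 1 ∧ h * g = 1 ∧
      Function.Injective y ∧ Y = g * diagonal y * h := by
  classical
  have hcard : Y.charpoly.roots.toFinset.card = n := by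
    rw [Multiset.toFinset_card_of_nodup hY, ← (IsAlgClosed.splits _).natDegree_eq_card_roots,
      Matrix.charpoly_natDegree_eq_dim, Fintype.card_fin]
  let e := Y.charpoly.roots.toFinset.equivFinOfCardEq hcard
  let y : Fin n → K := fun r => e.symm r
  have hy : Function.Injective y := Subtype.val_injective.comp e.symm.injective
  have hev : ∀ r, ∃ v, Module.End.HasEigenvector (toLin' Y) (y r) v := by
    intro r
    apply Module.End.HasEigenvalue.exists_hasEigenvector
    rw [Module.End.hasEigenvalue_iff_isRoot_charpoly, Matrix.charpoly_toLin']
    have := (e.symm r).2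
    rw [Multiset.mem_toFinset] at this
    exact Polynomial.isRoot_of_mem_roots this
  choose v hv using hev
  let g : Matrix (Fin n) (Fin n) K := of fun a r => v r a
  have hlin : LinearIndependent K g.col :=
    Module.End.eigenvectors_linearIndependent' (toLin' Y) y hy v hv
  have hunit : IsUnit g := Matrix.linearIndependent_cols_iff_isUnit.1 hlin
  have hdet : IsUnit g.det := (Matrix.isUnit_iff_isUnit_det g).1 hunit
  refine ⟨g, g⁻¹, y, Matrix.mul_nonsing_inv _ hdet, Matrix.nonsing_inv_mul _ hdet, hy, ?_⟩
  have h1 : Y * g = g * diagonal y := by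
    ext a r
    have := congrFun (hv r).apply_eq_smul a
    rw [Matrix.mul_diagonal, mul_comm]
    exact this
  rw [← h1, mul_assoc, Matrix.mul_nonsing_inv _ hdet, mul_one]

theorem mem_cyclicColumn (X Y : Matrix (Fin n) (Fin n) ℂ) (i : Fin n → ℂ) :
    i ∈ cyclicColumn X Y i :=
  Submodule.subset_span ⟨1, Subalgebra.one_mem _, by simp⟩

theorem mulVec_mem_cyclicColumn {X Y : Matrix (Fin n) (Fin n) ℂ} {i : Fin n → ℂ}
    {A : Matrix (Fin n) (Fin n) ℂ} (hA : A ∈ Algebra.adjoin ℂ {X, Y}) {v : Fin n → ℂ}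
    (hv : v ∈ cyclicColumn X Y i) : A *ᵥ v ∈ cyclicColumn X Y i := by
  induction hv using Submodule.span_induction with
  | mem v hv =>
    obtain ⟨B, hB, rfl⟩ := hv
    exact Submodule.subset_span ⟨A * B, Subalgebra.mul_mem _ hA hB, by rw [mulVec_mulVec]⟩
  | zero => simp
  | add u v _ _ hu hv => rw [mulVec_add]; exact Submodule.add_mem _ hu hv
  | smul a v _ hv => rw [mulVec_smul]; exact Submodule.smul_mem _ _ hv

/-- `ℂ[X, Y] i` is the smallest subspace that contains `i` and is invariant under `X` and `Y`. -/
theorem cyclicColumn_le {X Y : Matrix (Fin n) (Fin n) ℂ} {i : Fin n → ℂ}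
    {W : Submodule ℂ (Fin n → ℂ)} (hi : i ∈ W) (hX : ∀ w ∈ W, X *ᵥ w ∈ W)
    (hY : ∀ w ∈ W, Y *ᵥ w ∈ W) : cyclicColumn X Y i ≤ W := by
  refine Submodule.span_le.2 ?_
  rintro _ ⟨A, hA, rfl⟩
  suffices ∀ w ∈ W, A *ᵥ w ∈ W from this i hi
  induction hA using Algebra.adjoin_induction with
  | mem A hA =>
    rcases hA with rfl | rfl
    · exact hX
    · exact hY
  | algebraMap a =>
    intro w hw
    rw [Algebra.algebraMap_eq_smul_one, smul_mulVec, one_mulVec]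
    exact W.smul_mem _ hw
  | add A B _ _ hA hB =>
    intro w hw
    rw [add_mulVec]
    exact W.add_mem (hA w hw) (hB w hw)
  | mul A B _ _ hA hB =>
    intro w hw
    rw [← mulVec_mulVec]
    exact hA _ (hB w hw)

theorem cyclicRow_eq_cyclicColumn_transpose (X Y : Matrix (Fin n) (Fin n) ℂ) (j : Fin n → ℂ) :
    cyclicRow X Y j = cyclicColumn Xᵀ Yᵀ j := by
  have key : ∀ X Y A : Matrix (Fin n) (Fin n) ℂ, A ∈ Algebra.adjoin ℂ {X, Y} →
      Aᵀ ∈ Algebra.adjoin ℂ {Xᵀ, Yᵀ} := by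
    intro X Y A hA
    induction hA using Algebra.adjoin_induction with
    | mem A hA =>
      apply Algebra.subset_adjoin
      rcases hA with rfl | rfl <;> simp
    | algebraMap a =>
      rw [Algebra.algebraMap_eq_smul_one, transpose_smul, transpose_one]
      exact Subalgebra.smul_mem _ (Subalgebra.one_mem _) a
    | add A B _ _ hA hB => rw [transpose_add]; exact Subalgebra.add_mem _ hA hB
    | mul A B _ _ hA hB => rw [transpose_mul]; exact Subalgebra.mul_mem _ hB hA
  rw [cyclicRow, cyclicColumn]
  congr 1
  ext v
  constructor
  · rintro ⟨A, hA, rfl⟩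
    exact ⟨Aᵀ, key _ _ _ hA, by rw [mulVec_transpose]⟩
  · rintro ⟨A, hA, rfl⟩
    refine ⟨Aᵀ, by simpa using key _ _ _ hA, by rw [vecMul_transpose]⟩

open Polynomial in
/-- In an eigenbasis of `Y`, and under the stated condition on the matrix `X'` of `X` in this basis,
`ℂ[X, Y] i` is spanned by the eigenvectors that occur in `i`. -/
theorem finrank_cyclicColumn {X Y g h X' : Matrix (Fin n) (Fin n) ℂ} {i i' y : Fin n → ℂ}
    (hgh : g * h = 1) (hhg : h * g = 1) (hy : Function.Injective y) (hX : X = g * X' * h)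
    (hY : Y = g * diagonal y * h) (hi : i = g *ᵥ i')
    (hX' : ∀ r s, r ≠ s → i' r = 0 → X' r s = 0) :
    Module.finrank ℂ (cyclicColumn X Y i) = Fintype.card {r // i' r ≠ 0} := by
  let b : {r // i' r ≠ 0} → Fin n → ℂ := fun r => g *ᵥ Pi.single r.1 1
  have hinj : Function.Injective (toLin' g) := by
    intro v w hvw
    have := congrArg (h *ᵥ ·) hvw
    simpa [hhg] using this
  have hb : LinearIndependent ℂ b := by
    have h1 : LinearIndependent ℂ (fun r : Fin n => (Pi.single r 1 : Fin n → ℂ)) :=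
      Pi.linearIndependent_single_one (Fin n) ℂ
    have h2 := h1.map' (toLin' g) (LinearMap.ker_eq_bot.2 hinj)
    exact h2.comp Subtype.val Subtype.val_injective
  have hmem : ∀ v : Fin n → ℂ, (∀ r, i' r = 0 → v r = 0) →
      g *ᵥ v ∈ Submodule.span ℂ (Set.range b) := by
    intro v hv
    have : g *ᵥ v = ∑ r, v r • (g *ᵥ Pi.single r 1) := by
      conv_lhs => rw [pi_eq_sum_univ' v, mulVec_sum]
      simp only [mulVec_smul]
    rw [this]
    refine Submodule.sum_mem _ fun r _ => ?_
    by_cases hr : i' r = 0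
    · rw [hv r hr, zero_smul]
      exact Submodule.zero_mem _
    · exact Submodule.smul_mem _ _ (Submodule.subset_span ⟨⟨r, hr⟩, rfl⟩)
  have hstable : ∀ Z Z' : Matrix (Fin n) (Fin n) ℂ, Z = g * Z' * h →
      (∀ r s, r ≠ s → i' r = 0 → Z' r s = 0) → ∀ w ∈ Submodule.span ℂ (Set.range b),
        Z *ᵥ w ∈ Submodule.span ℂ (Set.range b) := by
    intro Z Z' hZ hZ' w hw
    induction hw using Submodule.span_induction with
    | mem w hw =>
      obtain ⟨r, rfl⟩ := hw
      have : Z *ᵥ b r = g *ᵥ (Z' *ᵥ Pi.single r.1 1) := by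
        rw [hZ, mulVec_mulVec, mulVec_mulVec, mul_assoc, hhg, mul_one]
      rw [this]
      refine hmem _ fun s hs => ?_
      have hsr : s ≠ r.1 := by rintro rfl; exact r.2 hs
      rw [mulVec_single_one]
      exact hZ' s r.1 hsr hs
    | zero => simp
    | add u v _ _ hu hv => rw [mulVec_add]; exact Submodule.add_mem _ hu hv
    | smul a v _ hv => rw [mulVec_smul]; exact Submodule.smul_mem _ _ hv
  have heq : cyclicColumn X Y i = Submodule.span ℂ (Set.range b) := by
    apply le_antisymm
    · refine cyclicColumn_le (hi ▸ hmem i' fun r hr => hr) (hstable X X' hX hX')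
        (hstable Y (diagonal y) hY fun r s hrs _ => diagonal_apply_ne _ hrs)
    · refine Submodule.span_le.2 ?_
      rintro _ ⟨r, rfl⟩
      -- the Lagrange polynomial `p` at the eigenvalue `y r` cuts out the `r`-th component
      let p : ℂ[X] := Lagrange.basis Finset.univ y r.1
      have hp : ∀ s, p.eval (y s) = if s = r.1 then 1 else 0 := by
        intro s
        split_ifs with hs
        · rw [hs]; exact Lagrange.eval_basis_self hy.injOn (Finset.mem_univ _)
        · exact Lagrange.eval_basis_of_ne (Ne.symm hs) (Finset.mem_univ _)
      have hpY : Polynomial.aeval Y p = g * diagonal (fun s => p.eval (y s)) * h := by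
        have hu : ∀ q : ℂ[X], Polynomial.aeval Y q = g * diagonal (fun s => q.eval (y s)) * h := by
          intro q
          induction q using Polynomial.induction_on' with
          | add q₁ q₂ h₁ h₂ =>
            rw [map_add, h₁, h₂, ← add_mul, ← mul_add, diagonal_add]
            simp
          | monomial m a =>
            rw [Polynomial.aeval_monomial]
            have hm : Y ^ m = g * diagonal (y ^ m) * h := by
              induction m with
              | zero => simp [hgh]
              | succ m ih =>
                rw [pow_succ, ih, hY]
                calc g * diagonal (y ^ m) * h * (g * diagonal y * h)
                    = g * diagonal (y ^ m) * (h * g) * diagonal y * h := by noncomm_ring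
                  _ = _ := by
                    rw [hhg, mul_one, mul_assoc g, diagonal_mul_diagonal, pow_succ]; rfl
            rw [hm, Algebra.algebraMap_eq_smul_one, smul_mul_assoc, one_mul]
            rw [← smul_mul_assoc, ← mul_smul_comm, ← diagonal_smul]
            congr 3
            ext s
            simp
        exact hu p
      have hr : (i' r.1)⁻¹ • (Polynomial.aeval Y p *ᵥ i) = b r := by
        rw [hpY, hi, mulVec_mulVec, mul_assoc, hhg, mul_one, ← mulVec_mulVec, ← mulVec_smul]
        congr 1
        ext s
        rw [Pi.smul_apply, mulVec_diagonal, hp, Pi.single_apply]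
        split_ifs with hs
        · rw [hs, one_mul, smul_eq_mul, inv_mul_cancel₀ r.2]
        · simp
      rw [← hr]
      refine Submodule.smul_mem _ _ (mulVec_mem_cyclicColumn ?_ (mem_cyclicColumn X Y i))
      exact Algebra.adjoin_mono (by simp) (Polynomial.aeval_mem_adjoin_singleton ℂ Y)
  rw [heq, finrank_span_eq_card hb]

/-- The vector `u` with its first `k` coordinates replaced by zero. -/
def colPart (k : ℕ) (u : Fin n → ℂ) : Fin n → ℂ := fun r => if (r : ℕ) < k then 0 else u r

/-- The vector `u` with all but its first `k` coordinates replaced by zero. -/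
def rowPart (k : ℕ) (u : Fin n → ℂ) : Fin n → ℂ := fun r => if (r : ℕ) < k then u r else 0

theorem colPart_mul_rowPart (k : ℕ) (u : Fin n → ℂ) (r : Fin n) :
    colPart k u r * rowPart k u r = 0 := by
  simp only [colPart, rowPart]; split_ifs <;> simp

/-- The solution of `[X, Y] + i j = 0` with `Y = diagonal y`, in which `X` has diagonal `x` and the
vector `u` is split into the row `j`, which takes the first `k` coordinates, and the column `i`.
The denominators are nonzero for injective `y`. -/
def normalForm (k : ℕ) (x y u : Fin n → ℂ) : Quad n ℂ :=
  (of fun r s => if r = s then x r else -(colPart k u r * rowPart k u s) / (y s - y r),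
    diagonal y, colPart k u, rowPart k u)

theorem moment_diagonal_apply {K : Type*} [CommRing K] (X : Matrix (Fin n) (Fin n) K)
    (y i j : Fin n → K) (r s : Fin n) :
    moment X (diagonal y) i j r s = X r s * (y s - y r) + i r * j s := by
  rw [moment, Matrix.add_apply, Matrix.sub_apply, mul_diagonal, diagonal_mul, vecMulVec_apply]
  ring

theorem moment_normalForm (k : ℕ) (x u : Fin n → ℂ) {y : Fin n → ℂ} (hy : Function.Injective y) :
    moment (normalForm k x y u).1 (normalForm k x y u).2.1 (normalForm k x y u).2.2.1
      (normalForm k x y u).2.2.2 = 0 := by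
  ext r s
  simp only [normalForm]
  rw [moment_diagonal_apply, of_apply, Matrix.zero_apply]
  split_ifs with hrs
  · rw [hrs, colPart_mul_rowPart]; ring
  · rw [div_mul_cancel₀ _ (sub_ne_zero.2 fun h => hrs (hy h).symm)]; ring

theorem conj_conj {K : Type*} [CommRing K] {g h : Matrix (Fin n) (Fin n) K} (hgh : g * h = 1)
    (q : Quad n K) : conj h g (conj g h q) = q := by
  have e : ∀ A, g * (h * A * g) * h = A := fun A => by
    calc g * (h * A * g) * h = (g * h) * A * (g * h) := by noncomm_ring
      _ = A := by rw [hgh, one_mul, mul_one]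
  refine Prod.ext (e _) (Prod.ext (e _) (Prod.ext ?_ ?_))
  · simp [conj, hgh]
  · simp [conj, hgh]

/-- Every solution for which `Y` has distinct eigenvalues has a normal form. The eigenbasis is
ordered so that `k` is the size of the support of `j`. -/
theorem exists_normalForm (q : Quad n ℂ) (hq : moment q.1 q.2.1 q.2.2.1 q.2.2.2 = 0)
    (hY : q.2.1.charpoly.roots.Nodup) :
    ∃ (k : Fin (n + 1)) (g h : Matrix (Fin n) (Fin n) ℂ) (x y u : Fin n → ℂ), g * h = 1 ∧
      h * g = 1 ∧ Function.Injective y ∧ (∀ r : Fin n, (r : ℕ) < k → u r ≠ 0) ∧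
      q = conj h g (normalForm k x y u) := by
  classical
  obtain ⟨X, Y, i, j⟩ := q
  obtain ⟨g₀, h₀, y₀, hgh₀, hhg₀, hy₀, hYd₀⟩ := exists_eigenbasis Y hY
  have hkn : Fintype.card {r // (j ᵥ* g₀) r ≠ 0} < n + 1 :=
    Nat.lt_succ_of_le ((Fintype.card_subtype_le _).trans (Fintype.card_fin n).le)
  let k : Fin (n + 1) := ⟨_, hkn⟩
  -- reorder the eigenbasis so that the row is supported on the first `k` coordinates
  have hcard : Fintype.card {r : Fin n // (r : ℕ) < k} =
      Fintype.card {r // (j ᵥ* g₀) r ≠ 0} := by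
    rw [Fintype.card_subtype]
    have : (Finset.univ.filter fun r : Fin n => (r : ℕ) < k).card = min n k := by
      rw [Fin.card_filter_val_lt]
    rw [this]
    exact min_eq_right (Nat.lt_succ_iff.1 k.2)
  let e := Fintype.equivOfCardEq hcard
  let σ := e.extendSubtype
  have hσ : ∀ r : Fin n, (j ᵥ* g₀) (σ r) ≠ 0 ↔ (r : ℕ) < k := by
    intro r
    constructor
    · intro h
      by_contra hr
      exact e.extendSubtype_not_mem r hr h
    · exact e.extendSubtype_mem r
  let g := g₀.submatrix id σ
  let h := h₀.submatrix σ id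
  let y := y₀ ∘ σ
  have hy : Function.Injective y := hy₀.comp σ.injective
  have hgh : g * h = 1 := by
    simp only [g, h]
    rw [submatrix_mul_equiv, hgh₀, submatrix_id_id]
  have hhg : h * g = 1 := mul_eq_one_comm.1 hgh
  have hYd : h * Y * g = diagonal y := by
    have h1 : h * Y * g = (h₀ * Y * g₀).submatrix σ σ := by
      ext r s; simp [h, g, Matrix.mul_apply]
    rw [h1, hYd₀]
    have h2 : h₀ * (g₀ * diagonal y₀ * h₀) * g₀ = diagonal y₀ := by
      calc h₀ * (g₀ * diagonal y₀ * h₀) * g₀ = (h₀ * g₀) * diagonal y₀ * (h₀ * g₀) := by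
            noncomm_ring
        _ = _ := by rw [hhg₀, one_mul, mul_one]
    rw [h2]
    ext r s
    simp [diagonal_apply, y]
  have hm := moment_conj hgh X Y i j
  have hq' : moment X Y i j = 0 := hq
  rw [hYd, hq', mul_zero, zero_mul] at hm
  have hm' : ∀ r s, (h * X * g) r s * (y s - y r) + (h *ᵥ i) r * (j ᵥ* g) s = 0 := fun r s => by
    rw [← moment_diagonal_apply, hm]; rfl
  have hj : ∀ r, (j ᵥ* g) r ≠ 0 ↔ (r : ℕ) < k := hσ
  have hi : ∀ r : Fin n, (r : ℕ) < k → (h *ᵥ i) r = 0 := by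
    intro r hr
    have := hm' r r
    rw [sub_self, mul_zero, zero_add, mul_eq_zero] at this
    exact this.resolve_right ((hj r).2 hr)
  let u : Fin n → ℂ := fun r => if (r : ℕ) < k then (j ᵥ* g) r else (h *ᵥ i) r
  have hu1 : colPart k u = h *ᵥ i := by
    ext r
    simp only [colPart, u]
    split_ifs with hr
    · exact (hi r hr).symm
    · rfl
  have hu2 : rowPart k u = j ᵥ* g := by
    ext r
    simp only [rowPart, u]
    split_ifs with hr
    · rfl
    · exact (not_not.1 (mt (hj r).1 hr)).symm
  refine ⟨k, g, h, fun r => (h * X * g) r r, y, u, hgh, hhg, hy, fun r hr => ?_, ?_⟩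
  · simp only [u, if_pos hr]
    exact (hj r).2 hr
  · rw [← conj_conj hgh (X, Y, i, j)]
    congr 1
    simp only [conj, normalForm, hu1, hu2, hYd]
    refine Prod.ext ?_ rfl
    ext r s
    change (h * X * g) r s = if r = s then (h * X * g) r r
      else -((h *ᵥ i) r * (j ᵥ* g) s) / (y s - y r)
    split_ifs with hrs
    · rw [hrs]
    · rw [eq_div_iff (sub_ne_zero.2 fun h => hrs (hy h).symm)]
      exact eq_neg_of_add_eq_zero_left (hm' r s)

end Points

/-! ### Regular functions on principal open sets -/

section RegularFunctions

variable {τ σ : Type*}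

/-- The function `f` on affine space is regular on the principal open set `Δ ≠ 0`. Its values
elsewhere are irrelevant. -/
def IsRegularOn (Δ : MvPolynomial τ ℂ) (f : (τ → ℂ) → ℂ) : Prop :=
  ∃ (N : ℕ) (F : MvPolynomial τ ℂ), ∀ t, eval t Δ ≠ 0 → eval t Δ ^ N * f t = eval t F

variable {Δ : MvPolynomial τ ℂ}

theorem isRegularOn_eval (F : MvPolynomial τ ℂ) : IsRegularOn Δ fun t => eval t F :=
  ⟨0, F, fun t _ => by simp⟩

theorem IsRegularOn.add {f g : (τ → ℂ) → ℂ} (hf : IsRegularOn Δ f) (hg : IsRegularOn Δ g) :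
    IsRegularOn Δ fun t => f t + g t := by
  obtain ⟨N, F, hF⟩ := hf
  obtain ⟨K, G, hG⟩ := hg
  refine ⟨N + K, Δ ^ K * F + Δ ^ N * G, fun t ht => ?_⟩
  rw [map_add, map_mul, map_mul, ← hF t ht, ← hG t ht, map_pow, map_pow]
  ring

theorem IsRegularOn.mul {f g : (τ → ℂ) → ℂ} (hf : IsRegularOn Δ f) (hg : IsRegularOn Δ g) :
    IsRegularOn Δ fun t => f t * g t := by
  obtain ⟨N, F, hF⟩ := hf
  obtain ⟨K, G, hG⟩ := hg
  refine ⟨N + K, F * G, fun t ht => ?_⟩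
  rw [map_mul, ← hF t ht, ← hG t ht]
  ring

theorem IsRegularOn.sum {ι : Type*} (s : Finset ι) {f : ι → (τ → ℂ) → ℂ}
    (hf : ∀ i, IsRegularOn Δ (f i)) : IsRegularOn Δ fun t => ∑ i ∈ s, f i t := by
  classical
  induction s using Finset.induction_on with
  | empty => simpa using isRegularOn_eval (0 : MvPolynomial τ ℂ)
  | insert a s ha ih =>
    simp only [Finset.sum_insert ha]
    exact (hf a).add ih

theorem isRegularOn_inv {G : MvPolynomial τ ℂ} (hG : G ∣ Δ) :
    IsRegularOn Δ fun t => (eval t G)⁻¹ := by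
  obtain ⟨H, rfl⟩ := hG
  refine ⟨1, H, fun t ht => ?_⟩
  have : eval t G ≠ 0 := fun h => ht (by rw [map_mul, h, zero_mul])
  rw [pow_one, map_mul]
  field_simp

theorem IsRegularOn.of_dvd {Δ' : MvPolynomial τ ℂ} {f : (τ → ℂ) → ℂ} (hf : IsRegularOn Δ f)
    (h : Δ ∣ Δ') : IsRegularOn Δ' f := by
  obtain ⟨N, F, hF⟩ := hf
  obtain ⟨H, rfl⟩ := h
  refine ⟨N, F * H ^ N, fun t ht => ?_⟩
  have : eval t Δ ≠ 0 := fun h => ht (by rw [map_mul, h, zero_mul])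
  rw [map_mul, map_mul, ← hF t this, map_pow]
  ring

theorem isRegularOn_eval_comp {φ : (τ → ℂ) → σ → ℂ} (hφ : ∀ v, IsRegularOn Δ fun t => φ t v)
    (f : MvPolynomial σ ℂ) : IsRegularOn Δ fun t => eval (φ t) f := by
  induction f using MvPolynomial.induction_on with
  | C a => simpa using isRegularOn_eval (MvPolynomial.C a : MvPolynomial τ ℂ)
  | add p q hp hq => simpa using hp.add hq
  | mul_X p v hp => simpa using hp.mul (hφ v)

/-- A regular function that vanishes on a nonempty principal open subset vanishes identically. -/
theorem IsRegularOn.eq_zero {f : (τ → ℂ) → ℂ} (hf : IsRegularOn Δ f) {E : MvPolynomial τ ℂ}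
    (hΔ : Δ ≠ 0) (hE : E ≠ 0) (h : ∀ t, eval t Δ ≠ 0 → eval t E ≠ 0 → f t = 0) {t : τ → ℂ}
    (ht : eval t Δ ≠ 0) : f t = 0 := by
  obtain ⟨N, F, hF⟩ := hf
  have h0 : F * (Δ * E) = 0 := by
    apply MvPolynomial.funext
    intro s
    rw [map_mul, map_mul, map_zero]
    by_cases hs : eval s Δ = 0
    · simp [hs]
    by_cases hs' : eval s E = 0
    · simp [hs']
    rw [← hF s hs, h s hs hs', mul_zero, zero_mul]
  have hF0 : F = 0 := (mul_eq_zero.1 h0).resolve_right (mul_ne_zero hΔ hE)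
  have := hF t ht
  rw [hF0, map_zero, mul_eq_zero] at this
  exact this.resolve_left (pow_ne_zero _ ht)

/-- The image of a nonempty principal open set under a regular map is irreducible. -/
theorem isPrime_vanishingIdeal_image (hΔ : Δ ≠ 0) {φ : (τ → ℂ) → σ → ℂ}
    (hφ : ∀ v, IsRegularOn Δ fun t => φ t v) :
    (vanishingIdeal ℂ (φ '' {t | eval t Δ ≠ 0})).IsPrime := by
  rw [Ideal.isPrime_iff]
  constructor
  · rw [Ne, Ideal.eq_top_iff_one, mem_vanishingIdeal_iff]
    intro h
    obtain ⟨t, ht⟩ : ∃ t, eval t Δ ≠ 0 := by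
      by_contra! h
      exact hΔ (MvPolynomial.funext fun t => by rw [h, map_zero])
    simpa using h _ ⟨t, ht, rfl⟩
  · intro f g hfg
    by_contra! hcon
    simp only [mem_vanishingIdeal_iff, Set.forall_mem_image] at hcon hfg
    obtain ⟨hf, hg⟩ := hcon
    push Not at hf
    obtain ⟨s, hs, hfs⟩ := hf
    apply hg
    obtain ⟨N, F, hF⟩ := isRegularOn_eval_comp hφ f
    have hF0 : F ≠ 0 := by
      rintro rfl
      have := hF s hs
      rw [map_zero, mul_eq_zero] at this
      exact hfs (this.resolve_left (pow_ne_zero _ hs))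
    intro t ht
    refine (isRegularOn_eval_comp hφ g).eq_zero hΔ hF0 (fun r hr hFr => ?_) ht
    have h1 := hfg hr
    rw [map_mul, mul_eq_zero] at h1
    refine h1.resolve_left fun h2 => hFr ?_
    rw [← hF r hr]
    have h3 : eval (φ r) f = 0 := h2
    simp only [h3, mul_zero]

end RegularFunctions

/-! ### The prime ideals of the components -/

section Parametrization

variable {n : ℕ}

/-- A quadruple of complex matrices and vectors as a point of affine space. -/
def toPoint (q : Quad n ℂ) : Coord n → ℂ :=
  Sum.elim (fun p => q.1 p.1 p.2) (Sum.elim (fun p => q.2.1 p.1 p.2) (Sum.elim q.2.2.1 q.2.2.2))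

/-- A point of affine space as a quadruple, inverse to `toPoint`. -/
def ofPoint (z : Coord n → ℂ) : Quad n ℂ :=
  (of fun r s => z (.inl (r, s)), of fun r s => z (.inr (.inl (r, s))),
    fun r => z (.inr (.inr (.inl r))), fun r => z (.inr (.inr (.inr r))))

theorem toPoint_ofPoint (z : Coord n → ℂ) : toPoint (ofPoint z) = z := by
  ext (v | v | v | v) <;> rfl

/-- The variables of the parameter space: the entries of a matrix `g` and of vectors `x`, `y`,
`u`. -/
abbrev Param (n : ℕ) : Type := (Fin n × Fin n) ⊕ Fin n ⊕ Fin n ⊕ Fin n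

/-- The matrix `g` of a parameter. -/
def paramG (t : Param n → ℂ) : Matrix (Fin n) (Fin n) ℂ := of fun r s => t (.inl (r, s))

/-- The normal form with the vectors `x`, `y`, `u` of a parameter. -/
def paramNormal (k : ℕ) (t : Param n → ℂ) : Quad n ℂ :=
  normalForm k (fun r => t (.inr (.inl r))) (fun r => t (.inr (.inr (.inl r))))
    (fun r => t (.inr (.inr (.inr r))))

/-- The parametrization `(g, x, y, u) ↦ g · normalForm k x y u`. It is meaningful where `g` is
invertible and the entries of `y` are distinct. -/
def param (k : ℕ) (t : Param n → ℂ) : Quad n ℂ :=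
  conj (paramG t)⁻¹ (paramG t) (paramNormal k t)

/-- The determinant of the matrix `g`, as a polynomial on the parameter space. -/
def paramDet (n : ℕ) : MvPolynomial (Param n) ℂ :=
  (of fun r s : Fin n => (MvPolynomial.X (.inl (r, s)) : MvPolynomial (Param n) ℂ)).det

/-- The difference of two coordinates of `y`, as a polynomial on the parameter space. -/
def paramSub (p : Fin n × Fin n) : MvPolynomial (Param n) ℂ :=
  MvPolynomial.X (.inr (.inr (.inl p.2))) - MvPolynomial.X (.inr (.inr (.inl p.1)))

theorem eval_paramSub (p : Fin n × Fin n) (t : Param n → ℂ) : eval t (paramSub p) =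
    t (.inr (.inr (.inl p.2))) - t (.inr (.inr (.inl p.1))) := by
  rw [paramSub, map_sub, eval_X, eval_X]

/-- The product of the differences of the coordinates of `y`. -/
def paramDisc (n : ℕ) : MvPolynomial (Param n) ℂ :=
  ∏ p ∈ (Finset.univ : Finset (Fin n)).offDiag, paramSub p

/-- The product of the coordinates of `u`. -/
def paramProd (n : ℕ) : MvPolynomial (Param n) ℂ :=
  ∏ r : Fin n, MvPolynomial.X (.inr (.inr (.inr r)))

theorem eval_paramDet (t : Param n → ℂ) : eval t (paramDet n) = (paramG t).det := by
  rw [paramDet, RingHom.map_det]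
  congr 1
  ext r s
  simp [paramG]

theorem eval_paramDisc_ne_zero (t : Param n → ℂ) : eval t (paramDisc n) ≠ 0 ↔
    Function.Injective fun r => t (.inr (.inr (.inl r))) := by
  rw [paramDisc, map_prod, Finset.prod_ne_zero_iff]
  constructor
  · intro h r s hrs
    by_contra hne
    refine h (r, s) (by simpa using hne) ?_
    rw [eval_paramSub]
    exact sub_eq_zero.2 hrs.symm
  · rintro h ⟨r, s⟩ hrs
    rw [eval_paramSub]
    exact sub_ne_zero.2 fun h' => (by simpa using hrs : r ≠ s) (h h'.symm)

theorem eval_paramProd_ne_zero (t : Param n → ℂ) : eval t (paramProd n) ≠ 0 ↔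
    ∀ r, t (.inr (.inr (.inr r))) ≠ 0 := by
  simp [paramProd, Finset.prod_ne_zero_iff]

/-- The parameter with the given parts. -/
def mkParam (g : Matrix (Fin n) (Fin n) ℂ) (x y u : Fin n → ℂ) : Param n → ℂ :=
  Sum.elim (fun p => g p.1 p.2) (Sum.elim x (Sum.elim y u))

theorem param_mkParam (k : ℕ) {g h : Matrix (Fin n) (Fin n) ℂ} (hgh : g * h = 1)
    (x y u : Fin n → ℂ) : param k (mkParam g x y u) = conj h g (normalForm k x y u) := by
  have h1 : paramG (mkParam g x y u) = g := rfl
  have h2 : g⁻¹ = h := Matrix.inv_eq_right_inv hgh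
  rw [param, h1, h2]
  rfl

theorem paramDet_paramDisc_ne_zero : paramDet n * paramDisc n ≠ 0 := by
  intro h
  have := congrArg (eval (mkParam (1 : Matrix (Fin n) (Fin n) ℂ) 0 (fun r => ((r : ℕ) : ℂ)) 1)) h
  rw [map_mul, map_zero, mul_eq_zero] at this
  rcases this with h | h
  · rw [eval_paramDet] at h
    have h1 : paramG (mkParam (1 : Matrix (Fin n) (Fin n) ℂ) 0 (fun r => ((r : ℕ) : ℂ)) 1) = 1 :=
      rfl
    rw [h1, det_one] at h
    exact one_ne_zero h
  · exact (eval_paramDisc_ne_zero _).2 (fun r s hrs => Fin.ext (Nat.cast_injective hrs)) h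

theorem paramProd_ne_zero : paramProd n ≠ 0 :=
  Finset.prod_ne_zero_iff.2 fun _ _ => MvPolynomial.X_ne_zero _

theorem paramSub_dvd_paramDisc {r s : Fin n} (hrs : r ≠ s) : paramSub (r, s) ∣ paramDisc n := by
  rw [paramDisc]
  exact Finset.dvd_prod_of_mem paramSub (Finset.mem_offDiag.2
    ⟨Finset.mem_univ r, Finset.mem_univ s, hrs⟩)

theorem isRegularOn_param (k : ℕ) (v : Coord n) :
    IsRegularOn (paramDet n * paramDisc n) fun t => toPoint (param k t) v := by
  set Δ := paramDet n * paramDisc n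
  have hX : ∀ p : Param n, IsRegularOn Δ fun t => t p := fun p => by
    simpa using isRegularOn_eval (Δ := Δ) (MvPolynomial.X p)
  have h0 : IsRegularOn Δ fun _ => 0 := by
    simpa using isRegularOn_eval (Δ := Δ) 0
  have hneg : ∀ {f : (Param n → ℂ) → ℂ}, IsRegularOn Δ f → IsRegularOn Δ fun t => -f t := by
    intro f hf
    simpa using (isRegularOn_eval (Δ := Δ) (-1)).mul hf
  have hg : ∀ r s, IsRegularOn Δ fun t => paramG t r s := fun r s => hX _
  have hginv : ∀ r s, IsRegularOn Δ fun t => (paramG t)⁻¹ r s := by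
    intro r s
    have h1 := (isRegularOn_inv (Δ := Δ) (Dvd.intro _ rfl : paramDet n ∣ Δ)).mul
      (isRegularOn_eval (Δ := Δ)
      ((of fun r s : Fin n => (MvPolynomial.X (.inl (r, s)) :
        MvPolynomial (Param n) ℂ)).adjugate r s))
    convert h1 using 2 with t
    rw [Matrix.inv_def, Ring.inverse_eq_inv', Matrix.smul_apply, smul_eq_mul, eval_paramDet]
    congr 1
    have h2 := RingHom.map_adjugate (eval t) (of fun r s : Fin n =>
      (MvPolynomial.X (.inl (r, s)) : MvPolynomial (Param n) ℂ))
    have h3 := congrFun (congrFun h2 r) s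
    rw [RingHom.mapMatrix_apply, Matrix.map_apply] at h3
    rw [h3]
    congr 2
    ext a b
    simp [paramG]
  have hcol : ∀ r, IsRegularOn Δ fun t => colPart k (fun r => t (.inr (.inr (.inr r)))) r := by
    intro r
    simp only [colPart]
    split_ifs
    exacts [h0, hX _]
  have hrow : ∀ r, IsRegularOn Δ fun t => rowPart k (fun r => t (.inr (.inr (.inr r)))) r := by
    intro r
    simp only [rowPart]
    split_ifs
    exacts [hX _, h0]
  have hnX : ∀ r s, IsRegularOn Δ fun t => (paramNormal k t).1 r s := by
    intro r s
    simp only [paramNormal, normalForm, of_apply]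
    split_ifs with hrs
    · exact hX _
    · refine (hneg ((hcol r).mul (hrow s))).mul ?_
      have hdvd := Dvd.dvd.mul_left (paramSub_dvd_paramDisc hrs) (paramDet n)
      simpa only [eval_paramSub] using isRegularOn_inv hdvd
  have hnY : ∀ r s, IsRegularOn Δ fun t => (paramNormal k t).2.1 r s := by
    intro r s
    simp only [paramNormal, normalForm, diagonal_apply]
    split_ifs
    exacts [hX _, h0]
  have hmul : ∀ {A B : (Param n → ℂ) → Matrix (Fin n) (Fin n) ℂ},
      (∀ r s, IsRegularOn Δ fun t => A t r s) → (∀ r s, IsRegularOn Δ fun t => B t r s) →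
      ∀ r s, IsRegularOn Δ fun t => (A t * B t) r s := by
    intro A B hA hB r s
    simp only [Matrix.mul_apply]
    exact IsRegularOn.sum _ fun _ => (hA _ _).mul (hB _ _)
  rcases v with ⟨r, s⟩ | ⟨r, s⟩ | r | r
  · have h := hmul (A := fun t => paramG t * (paramNormal k t).1) (B := fun t => (paramG t)⁻¹)
      (hmul hg hnX) hginv r s
    exact h
  · have h := hmul (A := fun t => paramG t * (paramNormal k t).2.1) (B := fun t => (paramG t)⁻¹)
      (hmul hg hnY) hginv r s
    exact h
  · have h := IsRegularOn.sum Finset.univ fun s => (hg r s).mul (hcol s)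
    exact h
  · have h := IsRegularOn.sum Finset.univ fun s => (hrow s).mul (hginv s r)
    exact h

/-- The vanishing ideal of the points with a normal form of type `k` in which all coordinates of `u`
are nonzero. -/
def compIdeal (n k : ℕ) : Ideal (CoordRing n) :=
  vanishingIdeal ℂ ((fun t => toPoint (param k t)) ''
    {t : Param n → ℂ | eval t (paramDet n * paramDisc n * paramProd n) ≠ 0})

instance isPrime_compIdeal (n k : ℕ) : (compIdeal n k).IsPrime :=
  isPrime_vanishingIdeal_image (mul_ne_zero paramDet_paramDisc_ne_zero paramProd_ne_zero)
    fun v => (isRegularOn_param k v).of_dvd (Dvd.intro _ rfl)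

theorem mem_compIdeal_iff {k : ℕ} {f : CoordRing n} : f ∈ compIdeal n k ↔
    ∀ (g h : Matrix (Fin n) (Fin n) ℂ) (x y u : Fin n → ℂ), g * h = 1 → Function.Injective y →
      (∀ r, u r ≠ 0) → eval (toPoint (conj h g (normalForm k x y u))) f = 0 := by
  rw [compIdeal, mem_vanishingIdeal_iff, Set.forall_mem_image]
  constructor
  · intro hf g h x y u hgh hy hu
    have h1 := hf (x := mkParam g x y u) (by
      rw [Set.mem_ofPred_eq, map_mul, map_mul, mul_ne_zero_iff, mul_ne_zero_iff]
      refine ⟨⟨?_, (eval_paramDisc_ne_zero _).2 hy⟩, (eval_paramProd_ne_zero _).2 hu⟩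
      rw [eval_paramDet]
      exact Matrix.det_ne_zero_of_right_inverse (B := h) hgh)
    simp only [param_mkParam k hgh] at h1
    exact h1
  · intro hf t ht
    rw [Set.mem_ofPred_eq, map_mul, map_mul, mul_ne_zero_iff, mul_ne_zero_iff, eval_paramDet] at ht
    exact hf _ _ _ _ _ (Matrix.mul_nonsing_inv _ (isUnit_iff_ne_zero.2 ht.1.1))
      ((eval_paramDisc_ne_zero _).1 ht.1.2) ((eval_paramProd_ne_zero _).1 ht.2)

/-- An element of `compIdeal n k` also vanishes at the normal forms in which some coordinates of `u`
are zero. -/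
theorem eval_eq_zero_of_mem_compIdeal {k : ℕ} {f : CoordRing n} (hf : f ∈ compIdeal n k)
    {g h : Matrix (Fin n) (Fin n) ℂ} (hgh : g * h = 1) (x : Fin n → ℂ) {y : Fin n → ℂ}
    (hy : Function.Injective y) (u : Fin n → ℂ) :
    eval (toPoint (conj h g (normalForm k x y u))) f = 0 := by
  rw [← param_mkParam k hgh]
  refine (isRegularOn_eval_comp (isRegularOn_param k) f).eq_zero (E := paramProd n)
    paramDet_paramDisc_ne_zero paramProd_ne_zero (fun t ht ht' => ?_) ?_
  · rw [map_mul, mul_ne_zero_iff, eval_paramDet] at ht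
    exact mem_compIdeal_iff.1 hf _ _ _ _ _ (Matrix.mul_nonsing_inv _ (isUnit_iff_ne_zero.2 ht.1))
      ((eval_paramDisc_ne_zero _).1 ht.2) ((eval_paramProd_ne_zero _).1 ht')
  · rw [map_mul, mul_ne_zero_iff, eval_paramDet]
    exact ⟨Matrix.det_ne_zero_of_right_inverse (B := h) hgh, (eval_paramDisc_ne_zero _).2 hy⟩

end Parametrization

/-! ### The strata in terms of normal forms -/

section Strata

variable {n : ℕ}

theorem moment_conj_normalForm {g h : Matrix (Fin n) (Fin n) ℂ} (hhg : h * g = 1) (k : ℕ)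
    (x u : Fin n → ℂ) {y : Fin n → ℂ} (hy : Function.Injective y) :
    moment (conj h g (normalForm k x y u)).1 (conj h g (normalForm k x y u)).2.1
      (conj h g (normalForm k x y u)).2.2.1 (conj h g (normalForm k x y u)).2.2.2 = 0 := by
  simp only [conj]
  rw [moment_conj hhg, moment_normalForm k x u hy, mul_zero, zero_mul]

theorem nodup_roots_conj_normalForm {g h : Matrix (Fin n) (Fin n) ℂ} (hhg : h * g = 1) (k : ℕ)
    (x u : Fin n → ℂ) {y : Fin n → ℂ} (hy : Function.Injective y) :
    (conj h g (normalForm k x y u)).2.1.charpoly.roots.Nodup := by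
  have h1 : (conj h g (normalForm k x y u)).2.1.charpoly = (diagonal y).charpoly := by
    change (g * diagonal y * h).charpoly = _
    rw [Matrix.charpoly_mul_comm, ← mul_assoc, hhg, one_mul]
  have h2 : (diagonal y).charpoly =
      (Multiset.map (fun a => Polynomial.X - Polynomial.C a) (Finset.univ.val.map y)).prod := by
    rw [Matrix.charpoly_diagonal, Multiset.map_map]
    rfl
  rw [h1, h2, Polynomial.roots_multiset_prod_X_sub_C]
  exact (Multiset.nodup_map_iff_of_injective hy).2 Finset.univ.nodup

open scoped Classical in
theorem finrank_cyclicColumn_conj_normalForm {g h : Matrix (Fin n) (Fin n) ℂ} (hgh : g * h = 1)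
    (hhg : h * g = 1) (k : ℕ) (x u : Fin n → ℂ) {y : Fin n → ℂ} (hy : Function.Injective y) :
    Module.finrank ℂ (cyclicColumn (conj h g (normalForm k x y u)).1
      (conj h g (normalForm k x y u)).2.1 (conj h g (normalForm k x y u)).2.2.1) =
      Fintype.card {r // colPart k u r ≠ 0} := by
  refine (finrank_cyclicColumn hgh hhg hy rfl rfl rfl fun r s hrs hr => ?_).trans
    (Fintype.card_congr (Equiv.refl _))
  have hr' : colPart k u r = 0 := hr
  change (if r = s then x r else _) = 0
  rw [if_neg hrs, hr', zero_mul, neg_zero, zero_div]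

open scoped Classical in
theorem finrank_cyclicRow_conj_normalForm {g h : Matrix (Fin n) (Fin n) ℂ} (hgh : g * h = 1)
    (hhg : h * g = 1) (k : ℕ) (x u : Fin n → ℂ) {y : Fin n → ℂ} (hy : Function.Injective y) :
    Module.finrank ℂ (cyclicRow (conj h g (normalForm k x y u)).1
      (conj h g (normalForm k x y u)).2.1 (conj h g (normalForm k x y u)).2.2.2) =
      Fintype.card {r // rowPart k u r ≠ 0} := by
  rw [cyclicRow_eq_cyclicColumn_transpose, finrank_cyclicColumn (g := hᵀ) (h := gᵀ)
    (X' := (normalForm k x y u).1ᵀ) (i' := rowPart k u) (y := y) ?_ ?_ hy ?_ ?_ ?_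
    fun r s hrs hr => ?_]
  · rw [← transpose_mul, hgh, transpose_one]
  · rw [← transpose_mul, hhg, transpose_one]
  · simp only [conj, transpose_mul, mul_assoc]
  · simp only [conj, normalForm, transpose_mul, mul_assoc, diagonal_transpose]
  · exact (mulVec_transpose h (rowPart k u)).symm
  · change (if s = r then x s else _) = 0
    rw [if_neg hrs.symm, hr, mul_zero, neg_zero, zero_div]

theorem card_colPart_ne_zero {k : ℕ} (hk : k ≤ n) (u : Fin n → ℂ)
    [Fintype {r // colPart k u r ≠ 0}] :
    Fintype.card {r // colPart k u r ≠ 0} = n - k ↔ ∀ r : Fin n, k ≤ (r : ℕ) → u r ≠ 0 := by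
  classical
  have hcard : (Finset.univ.filter fun r : Fin n => ¬ (r : ℕ) < k).card = n - k := by
    have h1 := Finset.card_filter_add_card_filter_not (s := (Finset.univ : Finset (Fin n)))
      (fun r : Fin n => (r : ℕ) < k)
    rw [Fin.card_filter_val_lt, Finset.card_univ, Fintype.card_fin] at h1
    omega
  have hsub : (Finset.univ.filter fun r => colPart k u r ≠ 0) ⊆
      Finset.univ.filter fun r : Fin n => ¬ (r : ℕ) < k := by
    intro r hr
    rw [Finset.mem_filter] at hr ⊢
    refine ⟨hr.1, fun h => hr.2 (if_pos h)⟩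
  rw [Fintype.card_subtype, ← hcard]
  constructor
  · intro h r hr
    have h1 : r ∈ Finset.univ.filter fun r => colPart k u r ≠ 0 := by
      rw [Finset.eq_of_subset_of_card_le hsub h.ge]
      simpa using hr
    rw [Finset.mem_filter, colPart, if_neg (not_lt.2 hr)] at h1
    exact h1.2
  · intro h
    congr 1
    refine hsub.antisymm fun r hr => ?_
    rw [Finset.mem_filter] at hr ⊢
    refine ⟨hr.1, ?_⟩
    rw [colPart, if_neg hr.2]
    exact h r (not_lt.1 hr.2)

theorem card_rowPart_ne_zero {k : ℕ} (hk : k ≤ n) {u : Fin n → ℂ}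
    [Fintype {r // rowPart k u r ≠ 0}] (hu : ∀ r : Fin n, (r : ℕ) < k → u r ≠ 0) :
    Fintype.card {r // rowPart k u r ≠ 0} = k := by
  classical
  have h1 : (Finset.univ.filter fun r => rowPart k u r ≠ 0) =
      Finset.univ.filter fun r : Fin n => (r : ℕ) < k := by
    refine Finset.filter_congr fun r _ => ?_
    rw [rowPart]
    split_ifs with h
    · simp [h, hu r h]
    · simp [h]
  rw [Fintype.card_subtype, h1, Fin.card_filter_val_lt]
  exact min_eq_right hk

/-- The conditions that define `M'_k` single out the normal forms of type `k` in which all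
coordinates of `u` are nonzero. -/
theorem stratum_conditions_iff (k : Fin (n + 1)) (q : Quad n ℂ)
    (hq : moment q.1 q.2.1 q.2.2.1 q.2.2.2 = 0) :
    (q.2.1.charpoly.roots.Nodup ∧
      Module.finrank ℂ (cyclicColumn q.1 q.2.1 q.2.2.1) = n - (k : ℕ) ∧
      Module.finrank ℂ (cyclicRow q.1 q.2.1 q.2.2.2) = (k : ℕ)) ↔
    ∃ (g h : Matrix (Fin n) (Fin n) ℂ) (x y u : Fin n → ℂ), g * h = 1 ∧ Function.Injective y ∧
      (∀ r, u r ≠ 0) ∧ q = conj h g (normalForm k x y u) := by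
  classical
  have hkn : ∀ k : Fin (n + 1), (k : ℕ) ≤ n := fun k => Nat.lt_succ_iff.1 k.2
  constructor
  · rintro ⟨hY, hcol, hrow⟩
    obtain ⟨k', g, h, x, y, u, hgh, hhg, hy, hu, rfl⟩ := exists_normalForm q hq hY
    rw [finrank_cyclicRow_conj_normalForm hgh hhg _ _ _ hy,
      card_rowPart_ne_zero (hkn k') hu] at hrow
    obtain rfl : k' = k := Fin.ext hrow
    rw [finrank_cyclicColumn_conj_normalForm hgh hhg _ _ _ hy, card_colPart_ne_zero (hkn k')]
      at hcol
    refine ⟨g, h, x, y, u, hgh, hy, fun r => ?_, rfl⟩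
    rcases Nat.lt_or_ge r k' with hr | hr
    · exact hu r hr
    · exact hcol r hr
  · rintro ⟨g, h, x, y, u, hgh, hy, hu, rfl⟩
    have hhg : h * g = 1 := mul_eq_one_comm.1 hgh
    refine ⟨nodup_roots_conj_normalForm hhg _ _ _ hy, ?_, ?_⟩
    · rw [finrank_cyclicColumn_conj_normalForm hgh hhg _ _ _ hy, card_colPart_ne_zero (hkn k)]
      exact fun r _ => hu r
    · rw [finrank_cyclicRow_conj_normalForm hgh hhg _ _ _ hy,
        card_rowPart_ne_zero (hkn k) fun r _ => hu r]

end Strata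

/-! ### Minors of Krylov matrices -/

section Krylov

variable {n : ℕ}

/-- The minor with columns `c` of the matrix with rows `v, Y v, Y² v, …`. -/
def krylov {R : Type*} [CommRing R] {m : ℕ} (c : Fin m → Fin n) (Y : Matrix (Fin n) (Fin n) R)
    (v : Fin n → R) : R :=
  (of fun a b : Fin m => (Y ^ (a : ℕ) *ᵥ v) (c b)).det

theorem map_krylov {R S : Type*} [CommRing R] [CommRing S] (φ : R →+* S) {m : ℕ}
    (c : Fin m → Fin n) (Y : Matrix (Fin n) (Fin n) R) (v : Fin n → R) :
    φ (krylov c Y v) = krylov c (Y.map φ) (φ ∘ v) := by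
  rw [krylov, RingHom.map_det, krylov]
  congr 1
  ext a b
  have h1 : (Y.map φ) ^ (a : ℕ) = (Y ^ (a : ℕ)).map φ :=
    (map_pow φ.mapMatrix Y (a : ℕ)).symm
  rw [RingHom.mapMatrix_apply, Matrix.map_apply, of_apply, of_apply, h1, RingHom.map_mulVec]

theorem krylov_eq_zero {X Y : Matrix (Fin n) (Fin n) ℂ} {v : Fin n → ℂ} {m : ℕ}
    (c : Fin m → Fin n) (h : Module.finrank ℂ (cyclicColumn X Y v) < m) : krylov c Y v = 0 := by
  by_contra hne
  have hlin := Matrix.linearIndependent_rows_iff_isUnit.2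
    ((Matrix.isUnit_iff_isUnit_det _).2 (isUnit_iff_ne_zero.2 hne))
  have hlin' : LinearIndependent ℂ fun a : Fin m => Y ^ (a : ℕ) *ᵥ v :=
    LinearIndependent.of_comp (LinearMap.funLeft ℂ ℂ c) hlin
  have h1 := finrank_span_eq_card hlin'
  have h2 : Submodule.span ℂ (Set.range fun a : Fin m => Y ^ (a : ℕ) *ᵥ v) ≤
      cyclicColumn X Y v := by
    refine Submodule.span_le.2 ?_
    rintro _ ⟨a, rfl⟩
    exact mulVec_mem_cyclicColumn
      (Subalgebra.pow_mem _ (Algebra.subset_adjoin (by simp)) _) (mem_cyclicColumn X Y v)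
  have h3 := Submodule.finrank_mono h2
  rw [h1, Fintype.card_fin] at h3
  omega

theorem krylov_diagonal_ne_zero {m : ℕ} {c : Fin m → Fin n} (hc : Function.Injective c)
    {y v : Fin n → ℂ} (hy : Function.Injective y) (hv : ∀ b, v (c b) ≠ 0) :
    krylov c (diagonal y) v ≠ 0 := by
  have h1 : (of fun a b : Fin m => (diagonal y ^ (a : ℕ) *ᵥ v) (c b)) =
      (vandermonde (y ∘ c))ᵀ * diagonal (v ∘ c) := by
    ext a b
    rw [mul_diagonal, transpose_apply, vandermonde_apply, of_apply, diagonal_pow, mulVec_diagonal]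
    rfl
  rw [krylov, h1, det_mul, det_transpose, det_diagonal]
  exact mul_ne_zero (det_vandermonde_ne_zero_iff.2 (hy.comp hc))
    (Finset.prod_ne_zero_iff.2 fun b _ => hv b)

end Krylov

/-! ### Minimal primes -/

section MinimalPrimes

variable {n : ℕ}

theorem quadMap_eval (z : Coord n → ℂ) : quadMap (eval z) = ofPoint z := by
  refine Prod.ext ?_ (Prod.ext ?_ (Prod.ext ?_ ?_))
  · ext r s; simp [quadMap, ofPoint, genX]
  · ext r s; simp [quadMap, ofPoint, genY]
  · ext r; simp [quadMap, ofPoint, genI]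
  · ext r; simp [quadMap, ofPoint, genJ]

theorem quadMap_eval_toPoint (q : Quad n ℂ) : quadMap (eval (toPoint q)) = q := by
  rw [quadMap_eval]; rfl

theorem eval_krylov_column (q : Quad n ℂ) {m : ℕ} (c : Fin m → Fin n) :
    eval (toPoint q) (krylov c (genY n) (genI n)) = krylov c q.2.1 q.2.2.1 := by
  have h1 : (genY n).map (eval (toPoint q)) = q.2.1 :=
    congrArg (fun q : Quad n ℂ => q.2.1) (quadMap_eval_toPoint q)
  have h2 : eval (toPoint q) ∘ genI n = q.2.2.1 :=
    congrArg (fun q : Quad n ℂ => q.2.2.1) (quadMap_eval_toPoint q)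
  rw [map_krylov, h1, h2]

theorem eval_krylov_row (q : Quad n ℂ) {m : ℕ} (c : Fin m → Fin n) :
    eval (toPoint q) (krylov c (genY n)ᵀ (genJ n)) = krylov c q.2.1ᵀ q.2.2.2 := by
  have h1 : (genY n)ᵀ.map (eval (toPoint q)) = q.2.1ᵀ :=
    congrArg (fun q : Quad n ℂ => q.2.1ᵀ) (quadMap_eval_toPoint q)
  have h2 : eval (toPoint q) ∘ genJ n = q.2.2.2 :=
    congrArg (fun q : Quad n ℂ => q.2.2.2) (quadMap_eval_toPoint q)
  rw [map_krylov, h1, h2]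

theorem J_le_compIdeal (k : ℕ) : J n ≤ compIdeal n k := by
  refine Ideal.span_le.2 ?_
  rintro _ ⟨⟨r, s⟩, rfl⟩
  refine mem_compIdeal_iff.2 fun g h x y u hgh hy hu => ?_
  exact (evalAt_moment _ _ _ _ r s).trans (congrFun (congrFun
    (moment_conj_normalForm (mul_eq_one_comm.1 hgh) k x u hy) r) s)

theorem not_compIdeal_le {k l : Fin (n + 1)} (hkl : k ≠ l) : ¬ compIdeal n l ≤ compIdeal n k := by
  classical
  have hk : (k : ℕ) ≤ n := Nat.lt_succ_iff.1 k.2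
  have hl : (l : ℕ) ≤ n := Nat.lt_succ_iff.1 l.2
  intro hle
  have hy : Function.Injective fun r : Fin n => ((r : ℕ) : ℂ) :=
    fun r s hrs => Fin.ext (Nat.cast_injective hrs)
  have hone : ∀ q : Quad n ℂ, conj 1 1 q = q := fun q => by simp [conj]
  rcases lt_or_gt_of_ne (fun h => hkl (Fin.ext h) : (k : ℕ) ≠ l) with hlt | hlt
  · -- the `(n - k)`-minors of the vectors `Y ^ a i` separate the two components
    let c : Fin (n - k) → Fin n := fun b => ⟨k + b, by omega⟩
    have hmem : krylov c (genY n) (genI n) ∈ compIdeal n l := by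
      refine mem_compIdeal_iff.2 fun g h x y u hgh hy hu => ?_
      rw [eval_krylov_column]
      apply krylov_eq_zero (X := (conj h g (normalForm l x y u)).1)
      rw [finrank_cyclicColumn_conj_normalForm hgh (mul_eq_one_comm.1 hgh) _ _ _ hy,
        (card_colPart_ne_zero hl u).2 fun r _ => hu r]
      omega
    have h2 := mem_compIdeal_iff.1 (hle hmem) 1 1 0 _ 1 (one_mul 1) hy (fun _ => one_ne_zero)
    rw [hone, eval_krylov_column] at h2
    change krylov c (diagonal _) (colPart k 1) = 0 at h2
    refine krylov_diagonal_ne_zero (fun a b hab => ?_) hy (fun b => ?_) h2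
    · have := congrArg Fin.val hab
      simp only [c] at this
      exact Fin.ext (by omega)
    · simp [colPart, c]
  · -- the `k`-minors of the vectors `j Y ^ a` separate the two components
    let c : Fin k → Fin n := fun b => ⟨b, by omega⟩
    have hmem : krylov c (genY n)ᵀ (genJ n) ∈ compIdeal n l := by
      refine mem_compIdeal_iff.2 fun g h x y u hgh hy hu => ?_
      rw [eval_krylov_row]
      apply krylov_eq_zero (X := (conj h g (normalForm l x y u)).1ᵀ)
      rw [← cyclicRow_eq_cyclicColumn_transpose,
        finrank_cyclicRow_conj_normalForm hgh (mul_eq_one_comm.1 hgh) _ _ _ hy,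
        card_rowPart_ne_zero hl fun r _ => hu r]
      omega
    have h2 := mem_compIdeal_iff.1 (hle hmem) 1 1 0 _ 1 (one_mul 1) hy (fun _ => one_ne_zero)
    rw [hone, eval_krylov_row] at h2
    change krylov c (diagonal _)ᵀ (rowPart k 1) = 0 at h2
    rw [diagonal_transpose] at h2
    refine krylov_diagonal_ne_zero (fun a b hab => ?_) hy (fun b => ?_) h2
    · have := congrArg Fin.val hab
      exact Fin.ext this
    · simp [rowPart, c]

/-- Otherwise the product of the discriminant and one element of each `compIdeal n k`, all outside
of the given minimal prime, would vanish on all closed points of `M`. -/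
theorem exists_compIdeal_le {p : Ideal (CoordRing n)} (hp : p ∈ (J n).minimalPrimes) :
    ∃ k : Fin (n + 1), compIdeal n k ≤ p := by
  have hprime : p.IsPrime := hp.1.1
  have hdisc := (ringKrullDim_quotient_of_mem_associatedPrimes
    (mem_associatedPrimes_of_mem_minimalPrimes hp)).2.1
  by_contra! hcon
  have hcon' : ∀ k : Fin (n + 1), ∃ f ∈ compIdeal n k, f ∉ p := fun k =>
    Set.not_subset.1 (hcon k)
  choose f hf hfp using hcon'
  -- the product vanishes at every closed point of `M`
  have hvan : rootDisc (genY n) * ∏ k, f k ∈ vanishingIdeal ℂ (zeroLocus ℂ (J n)) := by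
    intro z hz
    change eval z _ = 0
    rw [map_mul, mul_eq_zero, or_iff_not_imp_left]
    intro hd
    have hq : moment (ofPoint z).1 (ofPoint z).2.1 (ofPoint z).2.2.1 (ofPoint z).2.2.2 = 0 := by
      rw [← quadMap_eval]
      exact moment_quadMap (eval z) fun f hf => hz f hf
    have hY : (ofPoint z).2.1.charpoly.roots.Nodup := by
      rw [← rootDisc_ne_zero_iff, ← quadMap_eval]
      change rootDisc ((genY n).map (eval z)) ≠ 0
      rw [map_rootDisc]
      exact hd
    obtain ⟨k, g, h, x, y, u, hgh, -, hy, -, hqe⟩ := exists_normalForm (ofPoint z) hq hY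
    rw [map_prod]
    refine Finset.prod_eq_zero (Finset.mem_univ k) ?_
    rw [← toPoint_ofPoint z, hqe]
    exact eval_eq_zero_of_mem_compIdeal (hf k) hgh x hy u
  rw [vanishingIdeal_zeroLocus_eq_radical] at hvan
  have h1 := (Ideal.IsPrime.radical_le_iff hprime).2 hp.1.2 hvan
  rcases hprime.mem_or_mem h1 with h2 | h2
  · exact hdisc h2
  · obtain ⟨k, -, hk⟩ := (Ideal.IsPrime.prod_mem_iff (hp := hprime)).1 h2
    exact hfp k hk

theorem compIdeal_mem_minimalPrimes (k : Fin (n + 1)) : compIdeal n k ∈ (J n).minimalPrimes := by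
  obtain ⟨p, hp, hpk⟩ := Ideal.exists_minimalPrimes_le (J_le_compIdeal (n := n) k)
  obtain ⟨l, hl⟩ := exists_compIdeal_le hp
  obtain rfl : k = l := by
    by_contra hkl
    exact not_compIdeal_le hkl (hl.trans hpk)
  rwa [le_antisymm hl hpk]

theorem minimalPrimes_J : (J n).minimalPrimes = Set.range fun k : Fin (n + 1) => compIdeal n k := by
  ext p
  constructor
  · intro hp
    obtain ⟨k, hk⟩ := exists_compIdeal_le hp
    exact ⟨k, le_antisymm hk (hp.2 ⟨isPrime_compIdeal n k, J_le_compIdeal k⟩ hk)⟩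
  · rintro ⟨k, rfl⟩
    exact compIdeal_mem_minimalPrimes k

end MinimalPrimes

/-! ### A Jacobian criterion -/

section JacobianCriterion

open IsLocalRing

/-- In a regular local ring, elements of the maximal ideal that are linearly independent in the
cotangent space generate it as soon as there are at least as many as the dimension. -/
theorem span_eq_maximalIdeal_of_linearIndependent {A : Type*} [CommRing A] [IsRegularLocalRing A]
    {ι : Type*} [Fintype ι] (f : ι → maximalIdeal A)
    (hf : ∀ a : ι → A, ∑ i, a i * (f i : A) ∈ maximalIdeal A ^ 2 → ∀ i, a i ∈ maximalIdeal A)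
    (hdim : ringKrullDim A ≤ Fintype.card ι) :
    Ideal.span (Set.range fun i => (f i : A)) = maximalIdeal A := by
  have hlin : LinearIndependent (ResidueField A) fun i => (maximalIdeal A).toCotangent (f i) := by
    rw [Fintype.linearIndependent_iff]
    intro c hc
    choose a ha using fun i => residue_surjective (c i)
    have h1 : (maximalIdeal A).toCotangent (∑ i, a i • f i) = 0 := by
      rw [map_sum, ← hc]
      refine Finset.sum_congr rfl fun i _ => ?_
      rw [map_smul, ← ha i]
      exact (algebraMap_smul (ResidueField A) (a i) _).symm
    rw [Ideal.toCotangent_eq_zero] at h1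
    intro i
    rw [← ha i, residue_eq_zero_iff]
    refine hf a ?_ i
    simpa using h1
  have hrank : Module.finrank (ResidueField A) (CotangentSpace A) ≤ Fintype.card ι := by
    have h1 := (IsRegularLocalRing.iff_finrank_cotangentSpace (R := A)).1 inferInstance
    rw [← h1] at hdim
    exact_mod_cast hdim
  have hspan := hlin.span_eq_top_of_card_eq_finrank'
    (le_antisymm hlin.fintype_card_le_finrank hrank)
  have h2 : Submodule.span A (Set.range f) = ⊤ := by
    rw [← CotangentSpace.span_image_eq_top_iff, ← Set.range_comp]
    exact hspan
  have h3 := congrArg (Submodule.map (maximalIdeal A).subtype) h2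
  rw [Submodule.map_span, Submodule.map_top, Submodule.range_subtype, ← Set.range_comp] at h3
  exact h3

theorem derivation_mem_of_mem_sq {k R : Type*} [CommRing k] [CommRing R] [Algebra k R]
    (D : Derivation k R R) {P : Ideal R} {x : R} (hx : x ∈ P ^ 2) : D x ∈ P := by
  rw [pow_two] at hx
  induction hx using Submodule.mul_induction_on' with
  | mem_mul_mem a ha b hb =>
    rw [D.leibniz]
    exact P.add_mem (P.mul_mem_right _ ha) (P.mul_mem_right _ hb)
  | add a _ b _ ha hb => rw [map_add]; exact P.add_mem ha hb

open scoped Classical in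
/-- A Jacobian criterion: if the differentials of the `f i` are linearly independent at the generic
point of the component `P` of their zero locus, then they generate `P` locally at `P`. -/
theorem map_span_eq_maximalIdeal {k R ι : Type*} [CommRing k] [CommRing R] [Algebra k R]
    [IsRegularRing R] [Fintype ι] (P : Ideal R) [P.IsPrime] (f : ι → R)
    (hmin : P ∈ (Ideal.span (Set.range f)).minimalPrimes)
    (hjac : ∀ c : ι → R, (∀ D : Derivation k R R, ∑ i, c i * D (f i) ∈ P) → ∀ i, c i ∈ P) :
    (Ideal.span (Set.range f)).map (algebraMap R (Localization.AtPrime P)) =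
      maximalIdeal (Localization.AtPrime P) := by
  have hfP : ∀ i, f i ∈ P := fun i => hmin.1.2 (Ideal.subset_span ⟨i, rfl⟩)
  have hmap := Localization.AtPrime.map_eq_maximalIdeal (I := P)
  have hmem : ∀ i, algebraMap R (Localization.AtPrime P) (f i) ∈
      maximalIdeal (Localization.AtPrime P) := fun i => hmap ▸ Ideal.mem_map_of_mem _ (hfP i)
  have hdim : ringKrullDim (Localization.AtPrime P) ≤ Fintype.card ι := by
    rw [IsLocalization.AtPrime.ringKrullDim_eq_height P]
    have hmin' : P ∈ (Ideal.span ((Finset.univ.image f : Finset R) : Set R)).minimalPrimes := by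
      rwa [Finset.coe_image, Finset.coe_univ, Set.image_univ]
    have h1 := Ideal.height_le_card_of_mem_minimalPrimes_span_finset hmin'
    have h2 : ((Finset.univ.image f).card : ℕ∞) ≤ Fintype.card ι :=
      Nat.cast_le.2 Finset.card_image_le
    exact_mod_cast h1.trans h2
  have hspan := span_eq_maximalIdeal_of_linearIndependent
    (fun i => ⟨algebraMap R (Localization.AtPrime P) (f i), hmem i⟩) ?_ hdim
  · rw [Ideal.map_span, ← Set.range_comp]
    exact hspan
  intro a ha
  -- clear denominators
  obtain ⟨b, hb⟩ := IsLocalization.exist_integer_multiples P.primeCompl Finset.univ a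
  choose c hc using fun i => hb i (Finset.mem_univ i)
  have h1 : algebraMap R (Localization.AtPrime P) (∑ i, c i * f i) ∈
      (P ^ 2).map (algebraMap R (Localization.AtPrime P)) := by
    rw [Ideal.map_pow, hmap, map_sum]
    have h2 := Ideal.mul_mem_left _ (algebraMap R (Localization.AtPrime P) b) ha
    rw [Finset.mul_sum] at h2
    convert h2 using 2 with i
    rw [map_mul, hc, Algebra.smul_def, mul_assoc]
  rw [IsLocalization.algebraMap_mem_map_algebraMap_iff P.primeCompl] at h1
  obtain ⟨m, hm, hmP⟩ := h1
  have h3 : ∀ i, c i ∈ P := by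
    refine hjac c fun D => ?_
    have h4 := derivation_mem_of_mem_sq D hmP
    have h5 : D (m * ∑ i, c i * f i) = m * ∑ i, c i * D (f i) +
        ∑ i, (m * D (c i) + c i * D m) * f i := by
      rw [D.leibniz, map_sum]
      simp only [D.leibniz, smul_eq_mul, Finset.mul_sum, Finset.sum_mul, ← Finset.sum_add_distrib]
      refine Finset.sum_congr rfl fun i _ => ?_
      ring
    rw [h5] at h4
    have h6 : ∑ i, (m * D (c i) + c i * D m) * f i ∈ P :=
      P.sum_mem fun i _ => P.mul_mem_left _ (hfP i)
    exact ((‹P.IsPrime›).mem_or_mem ((P.add_mem_iff_left h6).1 h4)).resolve_left hm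
  intro i
  have h7 : algebraMap R (Localization.AtPrime P) b * a i ∈
      maximalIdeal (Localization.AtPrime P) := by
    rw [← Algebra.smul_def, ← hmap]
    have := hc i
    rw [← this]
    exact Ideal.mem_map_of_mem _ (h3 i)
  refine ((maximalIdeal.isMaximal _).isPrime.mem_or_mem h7).resolve_left ?_
  rw [← hmap, IsLocalization.algebraMap_mem_map_algebraMap_iff P.primeCompl]
  rintro ⟨m', hm', h8⟩
  exact (‹P.IsPrime›.mem_or_mem h8).elim hm' b.2

/-- An ideal that agrees with each of its associated primes locally at that prime is radical. -/
theorem isRadical_of_forall_map_eq_maximalIdeal {R : Type*} [CommRing R] [IsNoetherianRing R]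
    {I : Ideal R} (h : ∀ P ∈ associatedPrimes R (R ⧸ I), ∀ _ : P.IsPrime,
      I.map (algebraMap R (Localization.AtPrime P)) = maximalIdeal (Localization.AtPrime P)) :
    I.IsRadical := by
  intro x hx
  by_contra hxI
  have hx0 : Ideal.Quotient.mk I x ≠ 0 := by rwa [Ne, Ideal.Quotient.eq_zero_iff_mem]
  obtain ⟨P, hP, hle⟩ := exists_le_isAssociatedPrime_of_isNoetherianRing R _ hx0
  have hprime : P.IsPrime := hP.isPrime
  have hIP : I ≤ P := by
    have := hP.annihilator_le
    rwa [Submodule.annihilator_top, Ideal.annihilator_quotient] at this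
  have hxP : x ∈ P := hprime.radical_le_iff.2 hIP hx
  have h1 : algebraMap R (Localization.AtPrime P) x ∈
      I.map (algebraMap R (Localization.AtPrime P)) := by
    rw [h P hP hprime, ← Localization.AtPrime.map_eq_maximalIdeal]
    exact Ideal.mem_map_of_mem _ hxP
  rw [IsLocalization.algebraMap_mem_map_algebraMap_iff P.primeCompl] at h1
  obtain ⟨u, hu, hux⟩ := h1
  refine hu (hle ?_)
  rw [Submodule.mem_colon_singleton, Submodule.mem_bot]
  exact Ideal.Quotient.eq_zero_iff_mem.2 hux

end JacobianCriterion

/-! ### Reducedness -/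

section Reduced

variable {n : ℕ}

theorem dmoment_map {R S : Type*} [CommRing R] [CommRing S] (φ : R →+* S) (q v : Quad n R)
    (q' v' : Quad n S) (hq : q' = (q.1.map φ, q.2.1.map φ, φ ∘ q.2.2.1, φ ∘ q.2.2.2))
    (hv : v' = (v.1.map φ, v.2.1.map φ, φ ∘ v.2.2.1, φ ∘ v.2.2.2)) :
    (dmoment q v).map φ = dmoment q' v' := by
  subst hq hv
  ext r s
  simp [dmoment, Matrix.mul_apply, vecMulVec_apply]

theorem eval_mkDerivation_moment (q w : Quad n ℂ) (r s : Fin n) :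
    eval (toPoint q) (mkDerivation ℂ (fun v => (MvPolynomial.C (toPoint w v) : CoordRing n))
      (moment (genX n) (genY n) (genI n) (genJ n) r s)) = dmoment q w r s := by
  set D := mkDerivation ℂ (fun v => (MvPolynomial.C (toPoint w v) : CoordRing n))
  have h1 := moment_map_derivation D (genX n) (genY n) (genI n) (genJ n)
  have h2 := dmoment_map (eval (toPoint q)) (genX n, genY n, genI n, genJ n)
    (tangent D (genX n, genY n, genI n, genJ n)) q w (quadMap_eval_toPoint q).symm (by
      have hD : ∀ v, eval (toPoint q) (D (MvPolynomial.X v)) = toPoint w v := fun v => by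
        rw [mkDerivation_X, eval_C]
      refine Prod.ext ?_ (Prod.ext ?_ (Prod.ext ?_ ?_))
      · ext r s; exact (hD (.inl (r, s))).symm
      · ext r s; exact (hD (.inr (.inl (r, s)))).symm
      · ext r; exact (hD (.inr (.inr (.inl r)))).symm
      · ext r; exact (hD (.inr (.inr (.inr r)))).symm)
  rw [← h2, ← h1]
  rfl

/-- The infinitesimal stabilizer of a normal form with nonzero coordinates of `u` is trivial. -/
theorem eq_zero_of_gauge_eq_zero {k : ℕ} {g h Z : Matrix (Fin n) (Fin n) ℂ} (hgh : g * h = 1)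
    {x y u : Fin n → ℂ} (hy : Function.Injective y) (hu : ∀ r, u r ≠ 0)
    (hZ : gauge (conj h g (normalForm k x y u)) Z = 0) : Z = 0 := by
  have hhg : h * g = 1 := mul_eq_one_comm.1 hgh
  have hY : Z * (g * diagonal y * h) - g * diagonal y * h * Z = 0 :=
    congrArg (fun q : Quad n ℂ => q.2.1) hZ
  have hi : Z *ᵥ (g *ᵥ colPart k u) = 0 := congrArg (fun q : Quad n ℂ => q.2.2.1) hZ
  have hj : (rowPart k u ᵥ* h) ᵥ* Z = 0 :=
    neg_eq_zero.1 (congrArg (fun q : Quad n ℂ => q.2.2.2) hZ)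
  have hY' : h * Z * g * diagonal y = diagonal y * (h * Z * g) := by
    calc h * Z * g * diagonal y = h * (Z * (g * diagonal y * h)) * g := by
          rw [show h * (Z * (g * diagonal y * h)) * g = h * Z * g * diagonal y * (h * g) by
            noncomm_ring, hhg, mul_one]
      _ = h * (g * diagonal y * h * Z) * g := by rw [sub_eq_zero.1 hY]
      _ = diagonal y * (h * Z * g) := by
          rw [show h * (g * diagonal y * h * Z) * g = (h * g) * diagonal y * (h * Z * g) by
            noncomm_ring, hhg, one_mul]
  have hoff : ∀ r s, r ≠ s → (h * Z * g) r s = 0 := by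
    intro r s hrs
    have := congrFun (congrFun hY' r) s
    rw [mul_diagonal, diagonal_mul, mul_comm, ← sub_eq_zero, ← sub_mul, mul_eq_zero] at this
    exact this.resolve_left (sub_ne_zero.2 fun h => hrs (hy h).symm)
  have hi' : (h * Z * g) *ᵥ colPart k u = 0 := by
    rw [← mulVec_mulVec, ← mulVec_mulVec, hi, mulVec_zero]
  have hj' : rowPart k u ᵥ* (h * Z * g) = 0 := by
    rw [← vecMul_vecMul, ← vecMul_vecMul, hj, zero_vecMul]
  have hdiag : ∀ r, (h * Z * g) r r = 0 := by
    intro r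
    by_cases hr : (r : ℕ) < k
    · have h1 := congrFun hj' r
      rw [vecMul, dotProduct, Finset.sum_eq_single r (fun s _ hs => by rw [hoff s r hs, mul_zero])
        (by simp), Pi.zero_apply, mul_eq_zero] at h1
      refine h1.resolve_left ?_
      rw [rowPart, if_pos hr]
      exact hu r
    · have h1 := congrFun hi' r
      rw [mulVec, dotProduct, Finset.sum_eq_single r
        (fun s _ hs => by rw [hoff r s hs.symm, zero_mul]) (by simp), Pi.zero_apply,
        mul_eq_zero] at h1
      refine h1.resolve_right ?_
      rw [colPart, if_neg hr]
      exact hu r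
  have h0 : h * Z * g = 0 := by
    ext r s
    by_cases hrs : r = s
    · rw [← hrs]; exact hdiag r
    · exact hoff r s hrs
  calc Z = (g * h) * Z * (g * h) := by rw [hgh, one_mul, mul_one]
    _ = g * (h * Z * g) * h := by noncomm_ring
    _ = 0 := by rw [h0, mul_zero, zero_mul]

/-- The differential of the moment map is onto at the generic point of each component, since its
cokernel is dual to the infinitesimal stabilizer. -/
theorem mem_compIdeal_of_forall_derivation (k : ℕ) (c : Fin n × Fin n → CoordRing n)
    (hc : ∀ D : Derivation ℂ (CoordRing n) (CoordRing n), ∑ p, c p *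
      D (moment (genX n) (genY n) (genI n) (genJ n) p.1 p.2) ∈ compIdeal n k) (p : Fin n × Fin n) :
    c p ∈ compIdeal n k := by
  refine mem_compIdeal_iff.2 fun g h x y u hgh hy hu => ?_
  set q := conj h g (normalForm k x y u) with hq
  let Z : Matrix (Fin n) (Fin n) ℂ := of fun s r => eval (toPoint q) (c (r, s))
  have hZ : gauge q Z = 0 := by
    have h1 : symplecticForm n ℂ (gauge q Z) = 0 := by
      refine LinearMap.ext fun w => ?_
      rw [symplecticForm_swap, symplecticForm_gauge, neg_neg, LinearMap.zero_apply]
      have h2 := mem_compIdeal_iff.1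
        (hc (mkDerivation ℂ (fun v => (MvPolynomial.C (toPoint w v) : CoordRing n))))
        g h x y u hgh hy hu
      rw [← hq, map_sum, Fintype.sum_prod_type] at h2
      rw [← h2, Matrix.trace, Finset.sum_comm]
      refine Finset.sum_congr rfl fun s _ => ?_
      rw [Matrix.diag_apply, Matrix.mul_apply]
      refine Finset.sum_congr rfl fun r _ => ?_
      rw [map_mul, eval_mkDerivation_moment]
      rfl
    have h2 : gauge q Z ∈ LinearMap.ker (symplecticForm n ℂ) := h1
    rwa [symplecticForm_ker] at h2
  have hZ0 := eq_zero_of_gauge_eq_zero hgh hy hu hZ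
  exact congrFun (congrFun hZ0 p.2) p.1

theorem isRadical_J : (J n).IsRadical := by
  refine isRadical_of_forall_map_eq_maximalIdeal fun P hP hprime => ?_
  have hmin := (ringKrullDim_quotient_of_mem_associatedPrimes hP).2.2
  obtain ⟨k, rfl⟩ : P ∈ Set.range fun k : Fin (n + 1) => compIdeal n k := minimalPrimes_J ▸ hmin
  exact map_span_eq_maximalIdeal (k := ℂ) _ _ hmin
    fun c hc p => mem_compIdeal_of_forall_derivation k c hc p

end Reduced

/-! ### Passage to the scheme -/

section Components

variable {n : ℕ}

open PrimeSpectrum in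
theorem topologicalKrullDim_zeroLocus_ker {A B : Type*} [CommRing A] [CommRing B] (f : A →+* B)
    (hf : Function.Surjective f) :
    topologicalKrullDim (zeroLocus (RingHom.ker f : Set A)) = ringKrullDim B := by
  let e := (isClosedEmbedding_comap_of_surjective B f hf).isEmbedding.toHomeomorph
  rw [← topologicalKrullDim_eq_ringKrullDim, IsHomeomorph.topologicalKrullDim_eq e e.isHomeomorph,
    range_comap_of_surjective B f hf]

/-- The locus `M'_k` as a subset of the prime spectrum of the coordinate ring of `M`. -/
def stratumSpec (n : ℕ) (k : Fin (n + 1)) : Set (PrimeSpectrum (CoordRing n ⧸ J n)) := stratum n k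

theorem comap_vanishingIdeal_stratumSpec (k : Fin (n + 1)) :
    (PrimeSpectrum.vanishingIdeal (stratumSpec n k)).comap (Ideal.Quotient.mk (J n)) =
      compIdeal n k := by
  ext f
  rw [Ideal.mem_comap, PrimeSpectrum.mem_vanishingIdeal, mem_compIdeal_iff]
  constructor
  · intro hf g h x y u hgh hy hu
    have hq := moment_conj_normalForm (mul_eq_one_comm.1 hgh) k x u hy
    obtain ⟨h1, h2, h3⟩ := (stratum_conditions_iff k _ hq).2 ⟨g, h, x, y, u, hgh, hy, hu, rfl⟩
    exact hf (closedPoint hq) ⟨_, _, _, _, hq, h1, h2, h3, rfl⟩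
  · rintro hf _ ⟨X, Y, i, j, hq, h1, h2, h3, rfl⟩
    obtain ⟨g, h, x, y, u, hgh, hy, hu, hqe⟩ :=
      (stratum_conditions_iff k (X, Y, i, j) hq).1 ⟨h1, h2, h3⟩
    have h4 := hf g h x y u hgh hy hu
    rw [← hqe] at h4
    exact h4

theorem mem_minimalPrimes_quotient_iff {p : Ideal (CoordRing n ⧸ J n)} :
    p ∈ minimalPrimes (CoordRing n ⧸ J n) ↔
      ∃ k : Fin (n + 1), p = PrimeSpectrum.vanishingIdeal (stratumSpec n k) := by
  have hinj := Ideal.comap_injective_of_surjective (Ideal.Quotient.mk (J n))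
    Ideal.Quotient.mk_surjective
  have h2 := Ideal.comap_minimalPrimes_eq_of_surjective (f := Ideal.Quotient.mk (J n))
    Ideal.Quotient.mk_surjective ⊥
  rw [← RingHom.ker_eq_comap_bot, Ideal.mk_ker, minimalPrimes_J] at h2
  constructor
  · intro hp
    have h3 : p.comap (Ideal.Quotient.mk (J n)) ∈
        Set.range fun k : Fin (n + 1) => compIdeal n k := h2 ▸ ⟨p, hp, rfl⟩
    obtain ⟨k, hk⟩ := h3
    exact ⟨k, hinj (hk.symm.trans (comap_vanishingIdeal_stratumSpec k).symm)⟩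
  · rintro ⟨k, rfl⟩
    have h3 : compIdeal n k ∈ Set.range fun k : Fin (n + 1) => compIdeal n k := ⟨k, rfl⟩
    rw [h2] at h3
    obtain ⟨p, hp, hpk⟩ := h3
    rwa [← hinj (hpk.trans (comap_vanishingIdeal_stratumSpec k).symm)]

theorem irreducibleComponents_spec : irreducibleComponents (PrimeSpectrum (CoordRing n ⧸ J n)) =
    Set.range fun k => closure (stratumSpec n k) := by
  ext Z
  constructor
  · intro hZ
    rw [← PrimeSpectrum.zeroLocus_minimalPrimes] at hZ
    obtain ⟨p, hp, rfl⟩ := hZ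
    obtain ⟨k, rfl⟩ := mem_minimalPrimes_quotient_iff.1 hp
    exact ⟨k, (PrimeSpectrum.zeroLocus_vanishingIdeal_eq_closure _).symm⟩
  · rintro ⟨k, rfl⟩
    exact PrimeSpectrum.vanishingIdeal_mem_minimalPrimes.1
      (mem_minimalPrimes_quotient_iff.2 ⟨k, rfl⟩)

theorem closure_stratumSpec_injective :
    Function.Injective fun k => closure (stratumSpec n k) := by
  intro k l hkl
  by_contra hne
  refine not_compIdeal_le hne (le_of_eq ?_)
  rw [← comap_vanishingIdeal_stratumSpec, ← comap_vanishingIdeal_stratumSpec,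
    ← PrimeSpectrum.vanishingIdeal_closure (stratumSpec n l),
    ← PrimeSpectrum.vanishingIdeal_closure (stratumSpec n k)]
  exact congrArg (fun t => (PrimeSpectrum.vanishingIdeal t).comap (Ideal.Quotient.mk (J n)))
    hkl.symm

theorem ringKrullDim_quotient_compIdeal (k : Fin (n + 1)) :
    ringKrullDim (CoordRing n ⧸ compIdeal n k) = ((n ^ 2 + 2 * n : ℕ) : WithBot ℕ∞) :=
  (ringKrullDim_quotient_of_mem_associatedPrimes
    (mem_associatedPrimes_of_mem_minimalPrimes (compIdeal_mem_minimalPrimes k))).1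

theorem topologicalKrullDim_closure_stratumSpec (k : Fin (n + 1)) :
    topologicalKrullDim (closure (stratumSpec n k)) = ((n ^ 2 + 2 * n : ℕ) : WithBot ℕ∞) := by
  have hker : RingHom.ker (Ideal.Quotient.factor (J_le_compIdeal (n := n) k)) =
      PrimeSpectrum.vanishingIdeal (stratumSpec n k) := by
    apply Ideal.comap_injective_of_surjective (Ideal.Quotient.mk (J n))
      Ideal.Quotient.mk_surjective
    rw [comap_vanishingIdeal_stratumSpec, RingHom.comap_ker, Ideal.Quotient.factor_comp_mk,
      Ideal.mk_ker]
  rw [← PrimeSpectrum.zeroLocus_vanishingIdeal_eq_closure, ← hker,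
    topologicalKrullDim_zeroLocus_ker _ (Ideal.Quotient.factor_surjective _),
    ringKrullDim_quotient_compIdeal]

theorem ringKrullDim_quotient_J :
    ringKrullDim (CoordRing n ⧸ J n) = ((n ^ 2 + 2 * n : ℕ) : WithBot ℕ∞) := by
  refine le_antisymm ringKrullDim_quotient_J_le ?_
  rw [← ringKrullDim_quotient_compIdeal (n := n) 0]
  exact ringKrullDim_le_of_surjective (Ideal.Quotient.factor (J_le_compIdeal _))
    (Ideal.Quotient.factor_surjective _)

theorem isReduced_quotient_J : _root_.IsReduced (CoordRing n ⧸ J n) :=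
  (Ideal.isRadical_iff_quotient_reduced (J n)).1 isRadical_J

end Components

end AlmostCommuting

end

theorem theorem1p1 (n : ℕ) :
    AlmostCommuting.IsCompleteIntersection (AlmostCommuting.J n) ∧
    (irreducibleComponents (AlmostCommuting.M n) = Set.range (AlmostCommuting.component n) ∧
      Function.Injective (AlmostCommuting.component n)) ∧
    (AlgebraicGeometry.IsReduced (AlmostCommuting.M n) ∧
      (∀ Z ∈ irreducibleComponents (AlmostCommuting.M n),
        topologicalKrullDim Z = ((n ^ 2 + 2 * n : ℕ) : WithBot ℕ∞)) ∧
      topologicalKrullDim (AlmostCommuting.M n) = ((n ^ 2 + 2 * n : ℕ) : WithBot ℕ∞)) := by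
  have hirr : irreducibleComponents (AlmostCommuting.M n) =
      Set.range (AlmostCommuting.component n) := AlmostCommuting.irreducibleComponents_spec
  refine ⟨AlmostCommuting.isCompleteIntersection_J,
    ⟨hirr, AlmostCommuting.closure_stratumSpec_injective⟩, ?_, ?_, ?_⟩
  · have : _root_.IsReduced (CommRingCat.of (AlmostCommuting.CoordRing n ⧸ AlmostCommuting.J n)) :=
      AlmostCommuting.isReduced_quotient_J
    exact inferInstanceAs (AlgebraicGeometry.IsReduced
      (Spec (CommRingCat.of (AlmostCommuting.CoordRing n ⧸ AlmostCommuting.J n))))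
  · intro Z hZ
    rw [hirr] at hZ
    obtain ⟨k, rfl⟩ := hZ
    exact AlmostCommuting.topologicalKrullDim_closure_stratumSpec k
  · exact (PrimeSpectrum.topologicalKrullDim_eq_ringKrullDim _).trans
      AlmostCommuting.ringKrullDim_quotient_J
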